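/- **Problem.** Let $\mathcal I=\{1,\dots,I\}$ and consider $$\mathcal P^{pd}:\ \min_{x,y}\ f_0(y)+\sum_{i\in\mathcal I} f_i(x_i,y)\quad\text{s.t. } \tilde g_i(x_i,y)\preceq 0,\ \tilde h_i(x_i,y)=0,\ g_i(x_i)\preceq 0,\ x_i\in\mathcal X_i\ (i\in\mathcal I),\ g_0(y)\preceq 0,\ y\in\mathcal Y,$$ where $x_i\in\mathbb R^{n_i}$, $y\in\mathbb R^{n_0}$; $\mathcal X_i\subseteq\mathcal U_i$ and $\mathcal Y\subseteq\mathcal V$ are nonempty, closed and convex; $\mathcal U_i$ and $\mathcal V$ are open; all functions are continuously differentiable on $\mathcal U_i\times\mathcal V$, $\mathcal U_i$ or $\mathcal V$ respectively; $\nabla f_i$ is Lipschitz on $\mathcal X_i\times\mathcal Y$, $\nabla f_0$ is Lipschitz on $\mathcal Y$, and the objective is bounded below on the feasible set. For fixed $y$, the $i$-th subproblem minimises $f_i(\cdot,y)$ over $x_i\in\mathcal X_i$ with $\tilde g_i(x_i,y)\preceq0$, $\tilde h_i(x_i,y)=0$, $g_i(x_i)\preceq0$; $\operatorname{dom}f^\dagger$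 is the set of $y\in\mathcal V$ for which all subproblems are feasible. For a selection $x_i^\dagger(y)$ of stationary points of the subproblems, the master problem minimises $f^\dagger(y)=f_0(y)+\sum_i f_i(x_i^\dagger(y),y)$ subject to $g_0(y)\preceq 0$, $y\in\mathcal Y$. A point $x$ is *stationary* for $\min f$ s.t. $g\preceq0$, $h=0$, $x\in\mathcal X$ if it is feasible and there are $\mu\succeq0$ and $\lambda$ with $\mu\odot g(x)=0$ and $(\nabla f(x)+\nabla g(x)\mu+\nabla h(x)\lambda)^T(x'-x)\ge0$ for all $x'\in\mathcal X$. A feasible point $x$ is *regular* if $(\nabla g(x)\mu+\nabla h(x)\lambda)^T(x'-x)\ge0$ for all $x'\in\mathcal X$, $\mu\succeq0$, and $\mu_j=0$ whenever $g_j(x)\ne0$, together imply $\mu=0$ and $\lambda=0$. Assume that every feasible point of the master problem lying in $\operatorname{dom}f^\dagger$ is regular. **Algorithm (PD-A).** Let $F_0(\cdot;z)$ and $G_0(\cdot;z)$ ($z\in\mathcal Y$) be surrogates of $f_0$ and $g_0$ as follows. $F_0(\cdot;z)$ is continuously differentiable on $\mathcal V$; $(y-y')^T(\nabla_yF_0(y;z)-\nabla_yF_0(y';z))\ge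 c\|y-y'\|^2$ for $y,y',z\in\mathcal Y$; $\nabla_yF_0(z;z)=\nabla f_0(z)$ for $z\in\mathcal Y$; and $\nabla_yF_0(\cdot;\cdot)$ is continuous on $\mathcal V\times\mathcal Y$. On $\mathcal Y\times\mathcal Y$, $G_0$ is continuous, convex and differentiable in its first argument, and $\nabla_yG_0$ is continuous; $G_0(z;z)=g_0(z)$, $\nabla_yG_0(z;z)=\nabla g_0(z)$, $G_0(y;z)\succeq g_0(y)$. Let $\tau\ge0$, $c\ge 0$, $c+\tau>0$, and $\gamma^{(k)}\in(0,1]$, $\gamma^{(k)}\to0$, $\sum_k\gamma^{(k)}=\infty$. Start from $y^{(0)}\in\mathcal Y\cap\operatorname{dom}f^\dagger$ with $g_0(y^{(0)})\preceq0$. At iteration $k$, if $y^{(k)}\in\operatorname{dom}f^\dagger$: take any stationary points $x_i^\dagger(y^{(k)})$ of the subproblems at $y^{(k)}$ with corresponding multipliers $\tilde\mu_i(y^{(k)}),\tilde\lambda_i(y^{(k)}),\mu_i(y^{(k)})$ for $\tilde g_i,\tilde h_i,g_i$; put $d^{(k)}=\sum_i\big(\nabla_yf_i+\nabla_y\tilde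 g_i\,\tilde\mu_i(y^{(k)})+\nabla_y\tilde h_i\,\tilde\lambda_i(y^{(k)})\big)$, evaluated at $(x_i^\dagger(y^{(k)}),y^{(k)})$; let $y^*$ be the minimiser of $F_0(y;y^{(k)})+\frac\tau2\|y-y^{(k)}\|^2+(d^{(k)})^T(y-y^{(k)})$ over $y\in\mathcal Y$, $G_0(y;y^{(k)})\preceq0$; set $y^{(k+1)}=y^{(k)}+\gamma^{(k)}(y^*-y^{(k)})$. If $y^{(k)}\notin\operatorname{dom}f^\dagger$, set $y^{(k+1)}=y^{(k-1)}+\delta(y^{(k)}-y^{(k-1)})$ with some $\delta\in(0,1]$ such that $y^{(k+1)}\in\operatorname{dom}f^\dagger$. **Nondegenerate point.** Let $f_i,\tilde g_i,\tilde h_i,g_i$ be $C^2$ and let $(x^\ddagger,y^\ddagger)$, with $x_i^\ddagger\in\operatorname{int}\mathcal X_i$, be a stationary point of $\mathcal P^{pd}$ with multipliers $\tilde\mu_i^\ddagger,\tilde\lambda_i^\ddagger,\mu_i^\ddagger$ for $\tilde g_i,\tilde h_i,g_i$. For each $i$ assume strict complementarity (active components of $\tilde g_i,g_i$ have positive multipliers)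 and invertibility, at this point, of the derivative with respect to $(x_i,\tilde\mu_i,\tilde\lambda_i,\mu_i)$ of the KKT function of the $i$-th subproblem at $y^\ddagger$, whose components are: the $x_i$-gradient of the Lagrangian; $\tilde h_i$; and, for each inequality constraint, the constraint function if it is active at $(x_i^\ddagger,y^\ddagger)$ and its multiplier if not. A *stationary branch* on an open set $D\subseteq\operatorname{dom}f^\dagger$ consists of $C^1$ functions $X_i^\dagger,\widetilde M_i,\tilde\Lambda_i,M_i$ on $D$ such that, for every $y\in D$ and $i\in\mathcal I$, $X_i^\dagger(y)\in\operatorname{int}\mathcal X_i$ is a stationary point of the $i$-th subproblem at $y$ with the multipliers $\widetilde M_i(y),\tilde\Lambda_i(y),M_i(y)$. Assume that for every stationary branch taking the values $x_i^\ddagger,\tilde\mu_i^\ddagger,\tilde\lambda_i^\ddagger,\mu_i^\ddagger$ at $y^\ddagger\in D$, the gradient of $f^\dagger$ formed with $x_i^\dagger=X_i^\dagger$ is Lipschitz on some neighbourhood of $y^\ddagger$. **Theorem.** There exist an open set $D$, a stationary branch on $D$ through the given point, and neighbourhoods $\mathcal N_{y^\ddagger}\subseteq D$, $\mathcal N_{x_i^\ddagger},\mathcal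 N_{\tilde\mu_i^\ddagger},\mathcal N_{\tilde\lambda_i^\ddagger},\mathcal N_{\mu_i^\ddagger}$ of $y^\ddagger,x_i^\ddagger,\tilde\mu_i^\ddagger,\tilde\lambda_i^\ddagger,\mu_i^\ddagger$, such that for $y\in\mathcal N_{y^\ddagger}$ the branch values are the unique stationary point and multipliers of the $i$-th subproblem in $\mathcal N_{x_i^\ddagger}\times\mathcal N_{\tilde\mu_i^\ddagger}\times\mathcal N_{\tilde\lambda_i^\ddagger}\times\mathcal N_{\mu_i^\ddagger}$, and such that the following holds for all $F_0,G_0,c,\tau,\gamma$ as above and every run of PD-A with $y^{(k)}\in\mathcal N_{y^\ddagger}$, $x_i^\dagger(y^{(k)})\in\mathcal N_{x_i^\ddagger}$, $\tilde\mu_i(y^{(k)})\in\mathcal N_{\tilde\mu_i^\ddagger}$, $\tilde\lambda_i(y^{(k)})\in\mathcal N_{\tilde\lambda_i^\ddagger}$, $\mu_i(y^{(k)})\in\mathcal N_{\mu_i^\ddagger}$ for all $k$ and $i$, where the master problem is formed with $x_i^\dagger=X_i^\dagger$ on $D$. 1. Some subsequence $(y^{(k)})_{k\in\mathcal K}$ converges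 to a stationary point $y^{(\infty)}\in D$ of the master problem, and $\|y^{(k+1)}-y^{(k)}\|\to0$. If, in addition, $\mathcal Y$ is compact, $G_0$ is Lipschitz on $\mathcal Y\times\mathcal Y$, and $\nabla_yF_0(\cdot;z)$ and $\nabla_yF_0(y;\cdot)$ are uniformly Lipschitz on $\mathcal Y$, then the limit of every convergent subsequence of $(y^{(k)})$ lies in $D$ and is a stationary point of the master problem. 2. Along the subsequence in the first part of 1 (and, under the additional hypotheses, along every convergent subsequence), $x_i^\dagger(y^{(k)})$ converges for each $i$ to some $x_i^{(\infty)}\in\operatorname{int}\mathcal X_i$, and $(x^{(\infty)},y^{(\infty)})$ is a stationary point of $\mathcal P^{pd}$. -/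

import Mathlib

open Filter Topology

noncomputable section

/-- A nonlinear program on a real normed space `E`: minimise `f x` subject to `g j x ≤ 0`,
`h l x = 0` and `x ∈ X`. Functions are total; only their values near `X` matter. -/
structure NLP (E ι κ : Type) [NormedAddCommGroup E] [NormedSpace ℝ E] where
  f : E → ℝ
  g : ι → E → ℝ
  h : κ → E → ℝ
  X : Set E

namespace NLP

variable {E ι κ : Type} [NormedAddCommGroup E] [NormedSpace ℝ E] [Fintype ι] [Fintype κ]

/-- Feasible points. -/
def IsFeasible (P : NLP E ι κ) (x : E) : Prop :=
  x ∈ P.X ∧ (∀ j, P.g j x ≤ 0) ∧ ∀ l, P.h l x = 0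

/-- The derivative in `x` of the Lagrangian, `v ↦ (∇f + ∇g μ + ∇h λ)ᵀ v`. -/
def lagrangeDeriv (P : NLP E ι κ) (x : E) (μ : ι → ℝ) (lam : κ → ℝ) : E →L[ℝ] ℝ :=
  fderiv ℝ P.f x + ∑ j, μ j • fderiv ℝ (P.g j) x + ∑ l, lam l • fderiv ℝ (P.h l) x

/-- The KKT conditions at `x` with Lagrange multipliers `μ` and `lam`. -/
structure KKT (P : NLP E ι κ) (x : E) (μ : ι → ℝ) (lam : κ → ℝ) : Prop where
  variational : ∀ x' ∈ P.X, 0 ≤ P.lagrangeDeriv x μ lam (x' - x)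
  complementary : ∀ j, μ j * P.g j x = 0
  nonneg : ∀ j, 0 ≤ μ j
  feasible : P.IsFeasible x

/-- Stationary points: points that satisfy the KKT conditions with some multipliers. -/
def IsStationary (P : NLP E ι κ) (x : E) : Prop :=
  ∃ (μ : ι → ℝ) (lam : κ → ℝ), P.KKT x μ lam

/-- The Mangasarian-Fromovitz constraint qualification, in its dual form. -/
def IsRegularAt (P : NLP E ι κ) (x : E) : Prop :=
  ∀ (μ : ι → ℝ) (lam : κ → ℝ),
    (∀ x' ∈ P.X, 0 ≤ (∑ j, μ j • fderiv ℝ (P.g j) x + ∑ l, lam l • fderiv ℝ (P.h l) x) (x' - x)) →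
    (∀ j, 0 ≤ μ j) → (∀ j, P.g j x ≠ 0 → μ j = 0) → μ = 0 ∧ lam = 0

/-- The inequality constraints that are active at `x`. -/
def activeSet (P : NLP E ι κ) (x : E) : Set ι := {j | P.g j x = 0}

open Classical in
/-- The KKT function with index set `A`: the gradient of the Lagrangian, then `g j` for `j ∈ A`
and `μ j` for `j ∉ A`, then `h`. -/
def kktFun (P : NLP E ι κ) (A : Set ι) (z : E × (ι → ℝ) × (κ → ℝ)) :
    (E →L[ℝ] ℝ) × (ι → ℝ) × (κ → ℝ) :=
  (P.lagrangeDeriv z.1 z.2.1 z.2.2,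
    fun j => if j ∈ A then P.g j z.1 else z.2.1 j,
    fun l => P.h l z.1)

end NLP

/-- The data of the coupled problem: minimise `f0 y + ∑ i, f i (x i, y)` subject to
`gt i (x i, y) ≤ 0`, `ht i (x i, y) = 0`, `g i (x i) ≤ 0`, `x i ∈ X i`, `g0 y ≤ 0`, `y ∈ Y`.
`U i` and `V` are the open sets on which the functions are given. -/
structure PDProblem where
  I : ℕ
  n0 : ℕ
  r0 : ℕ
  n : Fin I → ℕ
  rt : Fin I → ℕ
  mt : Fin I → ℕ
  r : Fin I → ℕ
  U : (i : Fin I) → Set (EuclideanSpace ℝ (Fin (n i)))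
  X : (i : Fin I) → Set (EuclideanSpace ℝ (Fin (n i)))
  V : Set (EuclideanSpace ℝ (Fin n0))
  Y : Set (EuclideanSpace ℝ (Fin n0))
  f : (i : Fin I) → EuclideanSpace ℝ (Fin (n i)) × EuclideanSpace ℝ (Fin n0) → ℝ
  gt : (i : Fin I) → Fin (rt i) → EuclideanSpace ℝ (Fin (n i)) × EuclideanSpace ℝ (Fin n0) → ℝ
  ht : (i : Fin I) → Fin (mt i) → EuclideanSpace ℝ (Fin (n i)) × EuclideanSpace ℝ (Fin n0) → ℝ
  g : (i : Fin I) → Fin (r i) → EuclideanSpace ℝ (Fin (n i)) → ℝ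
  f0 : EuclideanSpace ℝ (Fin n0) → ℝ
  g0 : Fin r0 → EuclideanSpace ℝ (Fin n0) → ℝ

namespace PDProblem

/-- The space of the coupling variable `y`. -/
abbrev E0 (P : PDProblem) : Type := EuclideanSpace ℝ (Fin P.n0)

/-- The space of the block `x i`. -/
abbrev E (P : PDProblem) (i : Fin P.I) : Type := EuclideanSpace ℝ (Fin (P.n i))

/-- The whole problem in the variables `(x, y)`. -/
def full (P : PDProblem) :
    NLP ((∀ i, P.E i) × P.E0)
      ((Σ i, Fin (P.rt i)) ⊕ (Σ i, Fin (P.r i)) ⊕ Fin P.r0) (Σ i, Fin (P.mt i)) where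
  f z := P.f0 z.2 + ∑ i, P.f i (z.1 i, z.2)
  g := Sum.elim (fun s z => P.gt s.1 s.2 (z.1 s.1, z.2))
    (Sum.elim (fun s z => P.g s.1 s.2 (z.1 s.1)) (fun j z => P.g0 j z.2))
  h s z := P.ht s.1 s.2 (z.1 s.1, z.2)
  X := {z | (∀ i, z.1 i ∈ P.X i) ∧ z.2 ∈ P.Y}

/-- The `i`-th subproblem, for fixed `y`, in the variable `x i`. -/
def sub (P : PDProblem) (i : Fin P.I) (y : P.E0) :
    NLP (P.E i) (Fin (P.rt i) ⊕ Fin (P.r i)) (Fin (P.mt i)) where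
  f x := P.f i (x, y)
  g := Sum.elim (fun j x => P.gt i j (x, y)) (fun j x => P.g i j x)
  h l x := P.ht i l (x, y)
  X := P.X i

/-- The points `y` of `V` for which every subproblem is feasible. -/
def domDag (P : PDProblem) : Set P.E0 :=
  {y | y ∈ P.V ∧ ∀ i, ∃ x, (P.sub i y).IsFeasible x}

/-- The master objective `f†(y) = f0 y + ∑ i, f i (x†_i(y), y)` of a selection `X` of points. -/
def fDag (P : PDProblem) (X : (i : Fin P.I) → P.E0 → P.E i) (y : P.E0) : ℝ :=
  P.f0 y + ∑ i, P.f i (X i y, y)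

/-- The master problem of a selection `X`: minimise `f†` subject to `g0 y ≤ 0`, `y ∈ Y`. -/
def master (P : PDProblem) (X : (i : Fin P.I) → P.E0 → P.E i) :
    NLP P.E0 (Fin P.r0) (Fin 0) where
  f := P.fDag X
  g := P.g0
  h := fun _ _ => 0
  X := P.Y

/-- The standing assumptions on the problem. -/
structure Standing (P : PDProblem) : Prop where
  X_nonempty : ∀ i, (P.X i).Nonempty
  X_closed : ∀ i, IsClosed (P.X i)
  X_convex : ∀ i, Convex ℝ (P.X i)
  U_open : ∀ i, IsOpen (P.U i)
  X_subset : ∀ i, P.X i ⊆ P.U i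
  Y_nonempty : P.Y.Nonempty
  Y_closed : IsClosed P.Y
  Y_convex : Convex ℝ P.Y
  V_open : IsOpen P.V
  Y_subset : P.Y ⊆ P.V
  f_diff : ∀ i, ContDiffOn ℝ 1 (P.f i) (P.U i ×ˢ P.V)
  f_lip : ∀ i, ∃ K, LipschitzOnWith K (fderiv ℝ (P.f i)) (P.X i ×ˢ P.Y)
  f0_diff : ContDiffOn ℝ 1 P.f0 P.V
  f0_lip : ∃ K, LipschitzOnWith K (fderiv ℝ P.f0) P.Y
  gt_diff : ∀ i j, ContDiffOn ℝ 1 (P.gt i j) (P.U i ×ˢ P.V)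
  ht_diff : ∀ i l, ContDiffOn ℝ 1 (P.ht i l) (P.U i ×ˢ P.V)
  g_diff : ∀ i j, ContDiffOn ℝ 1 (P.g i j) (P.U i)
  g0_diff : ∀ j, ContDiffOn ℝ 1 (P.g0 j) P.V
  f_bdd : ∃ b : ℝ, ∀ z, P.full.IsFeasible z → b ≤ P.full.f z

/-- Every feasible point of the master problem is regular. Neither feasibility nor regularity
involves the objective, hence the selection `X` plays no role. -/
def MasterRegular (P : PDProblem) : Prop :=
  ∀ (X : (i : Fin P.I) → P.E0 → P.E i), ∀ y ∈ P.domDag,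
    (P.master X).IsFeasible y → (P.master X).IsRegularAt y

/-- `(xd, yd)` is a nondegenerate stationary point of the whole problem, with multipliers
`μtd`, `lamd`, `μd` (and some multiplier for `g0`): it is interior in `x`, the functions are `C²`,
for each subproblem the derivative of the KKT function with respect to `(x i, μ, lam)` is
invertible, and complementarity is strict. -/
structure Nondegenerate (P : PDProblem) (xd : ∀ i, P.E i) (yd : P.E0)
    (μtd : ∀ i, Fin (P.rt i) → ℝ) (lamd : ∀ i, Fin (P.mt i) → ℝ)
    (μd : ∀ i, Fin (P.r i) → ℝ) : Prop where
  f_diff2 : ∀ i, ContDiffOn ℝ 2 (P.f i) (P.U i ×ˢ P.V)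
  gt_diff2 : ∀ i j, ContDiffOn ℝ 2 (P.gt i j) (P.U i ×ˢ P.V)
  ht_diff2 : ∀ i l, ContDiffOn ℝ 2 (P.ht i l) (P.U i ×ˢ P.V)
  g_diff2 : ∀ i j, ContDiffOn ℝ 2 (P.g i j) (P.U i)
  interior : ∀ i, xd i ∈ interior (P.X i)
  stationary : ∃ μ0 : Fin P.r0 → ℝ, P.full.KKT (xd, yd)
    (Sum.elim (fun s => μtd s.1 s.2) (Sum.elim (fun s => μd s.1 s.2) μ0)) (fun s => lamd s.1 s.2)
  invertible : ∀ i,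
    (fderiv ℝ ((P.sub i yd).kktFun ((P.sub i yd).activeSet (xd i)))
      (xd i, Sum.elim (μtd i) (μd i), lamd i)).IsInvertible
  strict_gt : ∀ i j, P.gt i j (xd i, yd) = 0 → 0 < μtd i j
  strict_g : ∀ i j, P.g i j (xd i) = 0 → 0 < μd i j

/-- Candidate stationary points and multipliers of the subproblems, as functions of `y`. -/
structure Branch (P : PDProblem) where
  X : (i : Fin P.I) → P.E0 → P.E i
  Mt : (i : Fin P.I) → P.E0 → Fin (P.rt i) → ℝ
  Lt : (i : Fin P.I) → P.E0 → Fin (P.mt i) → ℝ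
  M : (i : Fin P.I) → P.E0 → Fin (P.r i) → ℝ

/-- On the open set `D`, the branch `B` is a continuously differentiable selection of interior
stationary points of the subproblems together with their multipliers. -/
structure IsStationaryBranch (P : PDProblem) (D : Set P.E0) (B : P.Branch) : Prop where
  D_open : IsOpen D
  D_subset : D ⊆ P.domDag
  X_diff : ∀ i, ContDiffOn ℝ 1 (B.X i) D
  Mt_diff : ∀ i, ContDiffOn ℝ 1 (B.Mt i) D
  Lt_diff : ∀ i, ContDiffOn ℝ 1 (B.Lt i) D
  M_diff : ∀ i, ContDiffOn ℝ 1 (B.M i) D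
  interior : ∀ i, ∀ y ∈ D, B.X i y ∈ interior (P.X i)
  kkt : ∀ i, ∀ y ∈ D, (P.sub i y).KKT (B.X i y) (Sum.elim (B.Mt i y) (B.M i y)) (B.Lt i y)

/-- The branch `B` takes the given values at `yd`. -/
def Branch.PassesThrough {P : PDProblem} (B : P.Branch) (xd : ∀ i, P.E i) (yd : P.E0)
    (μtd : ∀ i, Fin (P.rt i) → ℝ) (lamd : ∀ i, Fin (P.mt i) → ℝ)
    (μd : ∀ i, Fin (P.r i) → ℝ) : Prop :=
  ∀ i, B.X i yd = xd i ∧ B.Mt i yd = μtd i ∧ B.Lt i yd = lamd i ∧ B.M i yd = μd i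

/-- `∇f†` is Lipschitz continuous on a neighbourhood of `yd`, where `f†` is formed from the
stationary branch through the given point. Nothing is said here about the existence of a branch. -/
def GradDagLipschitz (P : PDProblem) (xd : ∀ i, P.E i) (yd : P.E0)
    (μtd : ∀ i, Fin (P.rt i) → ℝ) (lamd : ∀ i, Fin (P.mt i) → ℝ)
    (μd : ∀ i, Fin (P.r i) → ℝ) : Prop :=
  ∀ (D : Set P.E0) (B : P.Branch), P.IsStationaryBranch D B → yd ∈ D →
    B.PassesThrough xd yd μtd lamd μd →
    ∃ W ∈ 𝓝 yd, W ⊆ D ∧ ∃ K, LipschitzOnWith K (fderiv ℝ (P.fDag B.X)) W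

/-- The surrogate `F0(· ; z)` of `f0`, with modulus of strong convexity `c`. -/
structure IsObjSurrogate (P : PDProblem) (F0 : P.E0 → P.E0 → ℝ) (c : ℝ) : Prop where
  diff : ∀ z ∈ P.Y, ContDiffOn ℝ 1 (fun y => F0 y z) P.V
  mono : ∀ y ∈ P.Y, ∀ y' ∈ P.Y, ∀ z ∈ P.Y,
    c * ‖y - y'‖ ^ 2 ≤
      (fderiv ℝ (fun w => F0 w z) y - fderiv ℝ (fun w => F0 w z) y') (y - y')
  grad_eq : ∀ z ∈ P.Y, fderiv ℝ (fun w => F0 w z) z = fderiv ℝ P.f0 z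
  grad_cont : ContinuousOn (fun p : P.E0 × P.E0 => fderiv ℝ (fun w => F0 w p.2) p.1) (P.V ×ˢ P.Y)

/-- The surrogate `G0(· ; z)` of the constraint function `g0`. -/
structure IsConstrSurrogate (P : PDProblem) (G0 : P.E0 → P.E0 → Fin P.r0 → ℝ) : Prop where
  diff : ∀ z ∈ P.Y, ∀ y ∈ P.Y, ∀ j, DifferentiableAt ℝ (fun w => G0 w z j) y
  convex : ∀ z ∈ P.Y, ∀ j, ConvexOn ℝ P.Y (fun w => G0 w z j)
  eq_self : ∀ z ∈ P.Y, ∀ j, G0 z z j = P.g0 j z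
  upper : ∀ y ∈ P.Y, ∀ z ∈ P.Y, ∀ j, P.g0 j y ≤ G0 y z j
  cont : ∀ j, ContinuousOn (fun p : P.E0 × P.E0 => G0 p.1 p.2 j) (P.Y ×ˢ P.Y)
  grad_eq : ∀ z ∈ P.Y, ∀ j, fderiv ℝ (fun w => G0 w z j) z = fderiv ℝ (P.g0 j) z
  grad_cont : ∀ j, ContinuousOn
    (fun p : P.E0 × P.E0 => fderiv ℝ (fun w => G0 w p.2 j) p.1) (P.Y ×ˢ P.Y)

/-- The additional compactness and Lipschitz conditions. -/
structure ExtraConditions (P : PDProblem) (F0 : P.E0 → P.E0 → ℝ)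
    (G0 : P.E0 → P.E0 → Fin P.r0 → ℝ) : Prop where
  compact : IsCompact P.Y
  G0_lip : ∃ K, LipschitzOnWith K (fun p : P.E0 × P.E0 => G0 p.1 p.2) (P.Y ×ˢ P.Y)
  F0_lip_left : ∃ K, ∀ z ∈ P.Y, LipschitzOnWith K (fun y => fderiv ℝ (fun w => F0 w z) y) P.Y
  F0_lip_right : ∃ K, ∀ y ∈ P.Y, LipschitzOnWith K (fun z => fderiv ℝ (fun w => F0 w z) y) P.Y

/-- The step sizes: in `(0, 1]`, tending to zero, with divergent sum. -/
structure IsStepSize (γ : ℕ → ℝ) : Prop where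
  pos : ∀ k, 0 < γ k
  le_one : ∀ k, γ k ≤ 1
  tendsto_zero : Tendsto γ atTop (𝓝 0)
  sum_diverges : Tendsto (fun N => ∑ k ∈ Finset.range N, γ k) atTop atTop

/-- The vector `∇_y f_i + ∇_y gt_i μt + ∇_y ht_i lam` at `(x, y)`, as a linear functional. -/
def gradDag (P : PDProblem) (i : Fin P.I) (x : P.E i) (y : P.E0)
    (μt : Fin (P.rt i) → ℝ) (lam : Fin (P.mt i) → ℝ) : P.E0 →L[ℝ] ℝ :=
  fderiv ℝ (fun w => P.f i (x, w)) y + ∑ j, μt j • fderiv ℝ (fun w => P.gt i j (x, w)) y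
    + ∑ l, lam l • fderiv ℝ (fun w => P.ht i l (x, w)) y

/-- The convex approximate master problem at `z`, where `d` is the computed gradient of
the coupled part of the objective. -/
def approxMaster (P : PDProblem) (F0 : P.E0 → P.E0 → ℝ) (G0 : P.E0 → P.E0 → Fin P.r0 → ℝ)
    (τ : ℝ) (z : P.E0) (d : P.E0 →L[ℝ] ℝ) : NLP P.E0 (Fin P.r0) (Fin 0) where
  f := fun y => F0 y z + (τ / 2 * ‖y - z‖ ^ 2 + d (y - z))
  g := fun j y => G0 y z j
  h := fun _ _ => 0
  X := P.Y

/-- The sequences `y k`, `x k i` and the multipliers `μt k i`, `lam k i`, `μ k i` are generated by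
the primal decomposition algorithm. If some subproblem is infeasible at an iterate, the next
iterate is moved back towards the preceding one. -/
structure IsRun (P : PDProblem) (F0 : P.E0 → P.E0 → ℝ) (G0 : P.E0 → P.E0 → Fin P.r0 → ℝ)
    (τ : ℝ) (γ : ℕ → ℝ) (y : ℕ → P.E0) (x : ℕ → ∀ i, P.E i)
    (μt : ℕ → ∀ i, Fin (P.rt i) → ℝ) (lam : ℕ → ∀ i, Fin (P.mt i) → ℝ)
    (μ : ℕ → ∀ i, Fin (P.r i) → ℝ) : Prop where
  init_mem : y 0 ∈ P.Y
  init_le : ∀ j, P.g0 j (y 0) ≤ 0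
  init_dom : y 0 ∈ P.domDag
  subproblem : ∀ k, y k ∈ P.domDag → ∀ i,
    (P.sub i (y k)).KKT (x k i) (Sum.elim (μt k i) (μ k i)) (lam k i)
  step : ∀ k, y k ∈ P.domDag → ∃ ystar : P.E0,
    let Q := P.approxMaster F0 G0 τ (y k)
      (∑ i, P.gradDag i (x k i) (y k) (μt k i) (lam k i))
    Q.IsFeasible ystar ∧ (∀ w, Q.IsFeasible w → Q.f ystar ≤ Q.f w) ∧
      y (k + 1) = y k + γ k • (ystar - y k)
  fallback : ∀ k, y (k + 1) ∉ P.domDag → ∃ δ : ℝ, 0 < δ ∧ δ ≤ 1 ∧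
    y (k + 2) = y k + δ • (y (k + 1) - y k) ∧ y (k + 2) ∈ P.domDag

/-- Along the indices `φ`, the iterates `y` converge to `yInf ∈ D`, a stationary point of the
master problem formed with `X`, the iterates `x · i` converge to interior points `xInf i` of `X i`,
and `(xInf, yInf)` is a stationary point of the whole problem. -/
structure GoodLimit (P : PDProblem) (D : Set P.E0) (X : (i : Fin P.I) → P.E0 → P.E i)
    (y : ℕ → P.E0) (x : ℕ → ∀ i, P.E i) (φ : ℕ → ℕ) (yInf : P.E0) : Prop where
  tendsto_y : Tendsto (fun k => y (φ k)) atTop (𝓝 yInf)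
  mem : yInf ∈ D
  master_stationary : (P.master X).IsStationary yInf
  full_stationary : ∃ xInf : ∀ i, P.E i,
    (∀ i, Tendsto (fun k => x (φ k) i) atTop (𝓝 (xInf i)) ∧ xInf i ∈ interior (P.X i)) ∧
    P.full.IsStationary (xInf, yInf)

end PDProblem

end

/-! Near the given point, the KKT conditions of a subproblem are a system of `C¹` equations. Strict
complementarity keeps the active multipliers positive and the inactive constraints negative, and
interiority turns the variational inequality into the vanishing of the Lagrangian derivative
(`NLP.kkt_iff_kktFun_eq_zero`). The implicit function theorem gives a locally unique branch
(`NLP.exists_local_kkt_branch`). A run confined to the neighbourhoods can therefore only return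
values on this branch. By the envelope theorem (`PDProblem.IsStationaryBranch.hasFDerivAt_fDag`),
`∇f0 + d` is then the gradient of `f†`, and the algorithm is a successive convex approximation
method for `f†`.

Let `u k` minimise the approximate problem at `y k`, and let `a k = ‖u k - y k‖`. Comparing `u k`
with `y k` gives `∇f†(y k)(u k - y k) ≤ -(c + τ) (a k)²`. As `∇f†` is Lipschitz and `γ k → 0`, the
sum `∑ γ k (a k)²` converges. Divergence of `∑ γ k` makes `a k` small infinitely often, but this is
needed near a prescribed cluster point `p`. If `a k ≥ ε` held at all late iterates near `p`, the
path length `∑ γ k a k` would be at most `ε⁻¹ ∑ γ k (a k)²`; the iterates would never leave the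
ball, and `∑ γ k` would converge (`frequently_dist_lt_and_lt_of_mapClusterPt`).

So every cluster point is a limit of iterates with `a k → 0`, and there optimality passes to the
limit (`PDProblem.exists_multipliers_of_tendsto`). No multipliers of the approximate problems are
needed: the limit inequality is obtained for directions that make the linearised constraints
negative, and a Gordan alternative with regularity supplies the multipliers. Joined to those of the
branch, they satisfy the KKT conditions of the whole problem. -/

noncomputable section

/-! ### Theorems of alternatives and Lagrange multipliers -/

/-- A theorem of alternatives of Gordan type: if no point of a convex set makes finitely many affine
functions simultaneously negative, then some nonzero nonnegative combination of them is
nonnegative on the set. -/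
theorem Convex.exists_nonneg_combination {E ι : Type*} [AddCommGroup E] [Module ℝ E] [Fintype ι]
    {s : Set E} (hs : Convex ℝ s) (hne : s.Nonempty) (x₀ : E) (a : ι → ℝ) (ψ : ι → E →ₗ[ℝ] ℝ)
    (h : ∀ w ∈ s, ∃ j, 0 ≤ a j + ψ j (w - x₀)) :
    ∃ μ : ι → ℝ, (∀ j, 0 ≤ μ j) ∧ μ ≠ 0 ∧ ∀ w ∈ s, 0 ≤ ∑ j, μ j * (a j + ψ j (w - x₀)) := by
  classical
  set t : Set (ι → ℝ) := (fun w j => a j + ψ j (w - x₀)) '' s with ht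
  set N : Set (ι → ℝ) := Set.pi Set.univ fun _ => Set.Iio 0 with hN
  have hNc : Convex ℝ N := convex_pi fun _ _ => convex_Iio 0
  have hNo : IsOpen N := isOpen_set_pi Set.finite_univ fun _ _ => isOpen_Iio
  have htc : Convex ℝ t := by
    rintro _ ⟨w, hw, rfl⟩ _ ⟨w', hw', rfl⟩ p q hp hq hpq
    refine ⟨p • w + q • w', hs hw hw' hp hq hpq, ?_⟩
    funext j
    have : p • w + q • w' - x₀ = p • (w - x₀) + q • (w' - x₀) := by
      have : x₀ = (p + q) • x₀ := by rw [hpq, one_smul]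
      nth_rewrite 1 [this]
      module
    simp only [this, map_add, map_smul, Pi.add_apply, Pi.smul_apply, smul_eq_mul]
    have : a j = (p + q) * a j := by rw [hpq, one_mul]
    linear_combination this
  have hdisj : Disjoint N t := by
    rw [Set.disjoint_left]
    rintro _ hv ⟨w, hw, rfl⟩
    obtain ⟨j, hj⟩ := h w hw
    exact absurd (hv j trivial) (not_lt.mpr hj)
  -- The coefficients of the separating functional are the weights. It is bounded above on the cone
  -- `N`, hence nonpositive there, so the weights are nonnegative; `0` in the closure of `N` gives
  -- `0 ≤ u`; strictness on `N` excludes `f = 0`.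
  obtain ⟨f, u, hfu, huf⟩ := geometric_hahn_banach_open hNc hNo htc hdisj
  have hf0 : ∀ v ∈ N, f v ≤ 0 := by
    intro v hv
    by_contra! hpos
    obtain ⟨r, hr⟩ := exists_nat_gt (u / f v)
    have hr' : u < (r + 1) * f v := by
      rw [div_lt_iff₀ hpos] at hr
      linarith
    have hmem : ((r : ℝ) + 1) • v ∈ N := fun j _ => by
      have := hv j trivial
      simp only [Set.mem_Iio, Pi.smul_apply, smul_eq_mul] at this ⊢
      exact mul_neg_of_pos_of_neg (by positivity) this
    have := hfu _ hmem
    rw [map_smul, smul_eq_mul] at this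
    linarith
  have hclos : ∀ v : ι → ℝ, (∀ j, v j ≤ 0) → f v ≤ 0 := by
    intro v hv
    have hlim : Tendsto (fun ε : ℝ => f (v - ε • (1 : ι → ℝ))) (𝓝[>] 0) (𝓝 (f v)) := by
      have : ContinuousAt (fun ε : ℝ => f (v - ε • (1 : ι → ℝ))) 0 := by fun_prop
      simpa [ContinuousAt] using this.tendsto.mono_left nhdsWithin_le_nhds
    refine le_of_tendsto hlim ?_
    filter_upwards [self_mem_nhdsWithin] with ε hε
    refine hf0 _ fun j _ => ?_
    have := hv j
    simp only [Set.mem_Ioi] at hε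
    simp
    linarith
  have hu : 0 ≤ u := by
    have hlim : Tendsto (fun ε : ℝ => f (-(ε • (1 : ι → ℝ)))) (𝓝[>] 0) (𝓝 0) := by
      have : ContinuousAt (fun ε : ℝ => f (-(ε • (1 : ι → ℝ)))) 0 := by fun_prop
      simpa [ContinuousAt] using this.tendsto.mono_left nhdsWithin_le_nhds
    refine le_of_tendsto hlim ?_
    filter_upwards [self_mem_nhdsWithin] with ε hε
    refine (hfu _ fun j _ => ?_).le
    simpa using hε
  have hsum : ∀ v : ι → ℝ, f v = ∑ j, f (Pi.single j 1) * v j := by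
    intro v
    conv_lhs => rw [← Finset.univ_sum_single v]
    rw [map_sum]
    refine Finset.sum_congr rfl fun j _ => ?_
    have : Pi.single j (v j) = v j • (Pi.single j 1 : ι → ℝ) := by
      rw [← Pi.single_smul]; simp
    rw [this, map_smul, smul_eq_mul, mul_comm]
  refine ⟨fun j => f (Pi.single j 1), fun j => ?_, fun h0 => ?_, fun w hw => ?_⟩
  · have := hclos (-Pi.single j 1) fun i => by
      by_cases hij : i = j
      · subst hij; simp
      · simp [hij]
    rw [map_neg] at this
    linarith
  · have hz : ∀ v, f v = 0 := fun v => by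
      rw [hsum]
      exact Finset.sum_eq_zero fun j _ => by rw [congrFun h0 j]; simp
    obtain ⟨w, hw⟩ := hne
    have h1 := hfu (fun _ => -1) fun j _ => by simp
    have h2 := huf _ (Set.mem_image_of_mem _ hw)
    rw [hz] at h1 h2
    linarith
  · rw [← hsum fun j => a j + ψ j (w - x₀)]
    exact hu.trans (huf _ (Set.mem_image_of_mem _ hw))

/-- Lagrange multipliers from a first-order optimality condition and a dual constraint
qualification. -/
theorem Convex.exists_multipliers {E ι : Type*} [AddCommGroup E] [Module ℝ E] [Fintype ι]
    {s : Set E} (hs : Convex ℝ s) {x₀ : E} (hx₀ : x₀ ∈ s) (φ : E →ₗ[ℝ] ℝ) (a : ι → ℝ)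
    (ψ : ι → E →ₗ[ℝ] ℝ) (ha : ∀ j, a j ≤ 0)
    (hdir : ∀ w ∈ s, (∀ j, a j + ψ j (w - x₀) < 0) → 0 ≤ φ (w - x₀))
    (hreg : ∀ μ : ι → ℝ, (∀ w ∈ s, 0 ≤ ∑ j, μ j * ψ j (w - x₀)) → (∀ j, 0 ≤ μ j) →
      (∀ j, a j ≠ 0 → μ j = 0) → μ = 0) :
    ∃ μ : ι → ℝ, (∀ j, 0 ≤ μ j) ∧ (∀ j, μ j * a j = 0) ∧
      ∀ w ∈ s, 0 ≤ φ (w - x₀) + ∑ j, μ j * ψ j (w - x₀) := by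
  -- The objective joins the constraints as the index `none`, with constant term `0` (a Fritz John
  -- condition).
  obtain ⟨ν, hν, hν0, hsum⟩ := hs.exists_nonneg_combination ⟨x₀, hx₀⟩ x₀
    (fun o : Option ι => o.elim 0 a) (fun o => o.elim φ ψ) (fun w hw => by
      by_contra! hneg
      have := hdir w hw fun j => hneg (some j)
      have := hneg none
      simp only [Option.elim_none, zero_add] at this
      linarith)
  simp only [Fintype.sum_option, Option.elim_none, Option.elim_some, zero_add] at hsum
  -- At `w = x₀` only the constant terms remain: a nonnegative sum of nonpositive terms.
  have hcomp : ∀ j, ν (some j) * a j = 0 := by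
    have h1 := hsum x₀ hx₀
    simp only [sub_self, map_zero, mul_zero, zero_add, add_zero] at h1
    have h2 : ∀ j ∈ Finset.univ, ν (some j) * a j ≤ 0 := fun j _ =>
      mul_nonpos_of_nonneg_of_nonpos (hν _) (ha j)
    have h3 := (Finset.sum_eq_zero_iff_of_nonpos h2).mp
      (le_antisymm (Finset.sum_nonpos h2) h1)
    exact fun j => h3 j (Finset.mem_univ j)
  have hsum' : ∀ w ∈ s, 0 ≤ ν none * φ (w - x₀) + ∑ j, ν (some j) * ψ j (w - x₀) := by
    intro w hw
    simpa only [mul_add, hcomp, zero_add] using hsum w hw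
  -- If the objective had weight zero, the other weights would contradict the constraint
  -- qualification unless they all vanished.
  have hpos : 0 < ν none := by
    refine lt_of_le_of_ne (hν none) fun h0 => hν0 ?_
    have := hreg (fun j => ν (some j)) (fun w hw => by simpa [← h0] using hsum' w hw)
      (fun j => hν _) (fun j hj => (mul_eq_zero.mp (hcomp j)).resolve_right hj)
    funext o
    cases o with
    | none => exact h0.symm
    | some j => exact congrFun this j
  refine ⟨fun j => (ν none)⁻¹ * ν (some j), fun j => mul_nonneg (inv_nonneg.mpr hpos.le) (hν _),
    fun j => by rw [mul_assoc, hcomp, mul_zero], fun w hw => ?_⟩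
  have := mul_nonneg (inv_nonneg.mpr hpos.le) (hsum' w hw)
  rw [mul_add, inv_mul_cancel_left₀ hpos.ne', Finset.mul_sum] at this
  simpa only [mul_assoc] using this

/-! ### Sufficient decrease and divergent step sizes -/

/-- A function whose derivative is Lipschitz on a convex set lies below its linearisation plus a
quadratic term. -/
theorem Convex.le_add_fderiv_add_of_lipschitzOnWith {E : Type*} [NormedAddCommGroup E]
    [NormedSpace ℝ E] {f : E → ℝ} {s : Set E} {K : NNReal} (hs : Convex ℝ s)
    (hf : ∀ x ∈ s, DifferentiableAt ℝ f x) (hK : LipschitzOnWith K (fderiv ℝ f) s) {x y : E}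
    (hx : x ∈ s) (hy : y ∈ s) :
    f y ≤ f x + fderiv ℝ f x (y - x) + K * ‖y - x‖ ^ 2 := by
  -- The mean value theorem yields `K` where integration would yield `K / 2`; with vanishing step
  -- sizes the constant is immaterial.
  obtain ⟨z, hz, hfz⟩ := domain_mvt (fun w hw => (hf w hw).hasFDerivAt.hasFDerivWithinAt) hs hx hy
  have h1 : (fderiv ℝ f z - fderiv ℝ f x) (y - x) ≤ K * ‖y - x‖ * ‖y - x‖ := by
    refine (le_abs_self _).trans (((fderiv ℝ f z - fderiv ℝ f x).le_opNorm _).trans ?_)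
    refine mul_le_mul_of_nonneg_right ?_ (norm_nonneg _)
    refine (hK.norm_sub_le (hs.segment_subset hx hy hz) hx).trans ?_
    refine mul_le_mul_of_nonneg_left ?_ K.2
    rw [← dist_eq_norm, ← dist_eq_norm, dist_comm y x]
    have := dist_add_dist_of_mem_segment hz
    rw [dist_comm z x]
    linarith [dist_nonneg (x := z) (y := y)]
  rw [sub_apply] at h1
  nlinarith

/-- A sufficient decrease with vanishing step sizes makes the decrements summable. -/
theorem summable_mul_sq_of_decrease {γ a v : ℕ → ℝ} {η L b : ℝ} (hη : 0 < η)
    (hγ : ∀ k, 0 < γ k) (hγ0 : Tendsto γ atTop (𝓝 0)) (hb : ∀ k, b ≤ v k)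
    (hv : ∀ k, v (k + 1) ≤ v k - γ k * η * a k ^ 2 + L * γ k ^ 2 * a k ^ 2) :
    Summable fun k => γ k * a k ^ 2 := by
  -- From `N` on, the quadratic error consumes at most half of the decrease; the other half
  -- telescopes.
  obtain ⟨N, hN⟩ : ∃ N, ∀ k ≥ N, L * γ k ≤ η / 2 := by
    have : Tendsto (fun k => L * γ k) atTop (𝓝 (L * 0)) := hγ0.const_mul L
    rw [mul_zero] at this
    exact eventually_atTop.mp (this.eventually (ge_mem_nhds (by positivity)))
  rw [← summable_nat_add_iff N]
  have hdec : ∀ n, η / 2 * ∑ k ∈ Finset.range n, γ (k + N) * a (k + N) ^ 2 ≤ v N - v (n + N) := by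
    intro n
    induction n with
    | zero => simp
    | succ n ih =>
      rw [Finset.sum_range_succ, mul_add]
      have h1 := hv (n + N)
      have h2 := hN (n + N) (by omega)
      have h3 : 0 ≤ γ (n + N) * a (n + N) ^ 2 := mul_nonneg (hγ _).le (sq_nonneg _)
      have h4 := mul_le_mul_of_nonneg_right h2 h3
      rw [show n + 1 + N = n + N + 1 by ring]
      linarith
  refine summable_of_sum_range_le (c := (v N - b) / (η / 2))
    (fun k => mul_nonneg (hγ _).le (sq_nonneg _)) fun n => ?_
  rw [le_div_iff₀ (by positivity), mul_comm]
  linarith [hdec n, hb (n + N)]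

/-- If the steps `y (k + 1) - y k` have length `γ k * a k` where `∑ γ k * a k ^ 2` converges and
`∑ γ k` diverges, then near each cluster point of `y` there are iterates at which `a` is small. -/
theorem frequently_dist_lt_and_lt_of_mapClusterPt {E : Type*} [PseudoMetricSpace E] {γ a : ℕ → ℝ}
    {y : ℕ → E} {p : E} (hγ : ∀ k, 0 < γ k) (ha : ∀ k, 0 ≤ a k)
    (hdiv : Tendsto (fun N => ∑ k ∈ Finset.range N, γ k) atTop atTop)
    (hsum : Summable fun k => γ k * a k ^ 2) (hstep : ∀ k, dist (y (k + 1)) (y k) = γ k * a k)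
    (hp : MapClusterPt p atTop y) {ε : ℝ} (hε : 0 < ε) :
    ∃ᶠ k in atTop, dist (y k) p < ε ∧ a k < ε := by
  intro hev
  obtain ⟨N, hN⟩ := eventually_atTop.mp hev
  set S : ℕ → ℝ := fun n => ∑ k ∈ Finset.range n, γ k * a k ^ 2 with hS
  have hSm : ∀ n, S (n + 1) = S n + γ n * a n ^ 2 := fun n => Finset.sum_range_succ _ _
  have hSle : ∀ n, S n ≤ ∑' k, γ k * a k ^ 2 := fun n =>
    hsum.sum_le_tsum _ fun k _ => mul_nonneg (hγ k).le (sq_nonneg _)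
  -- A tail below `ε² / 2` bounds later displacements by `ε / 2`; starting within `ε / 2` of `p`,
  -- the iterates stay in the `ε`-ball.
  obtain ⟨M, hM⟩ : ∃ M, ∀ n ≥ M, ∑' k, γ k * a k ^ 2 - S n < ε * (ε / 2) := by
    have h1 : Tendsto (fun n => ∑' k, γ k * a k ^ 2 - S n) atTop (𝓝 0) := by
      have h0 := hsum.hasSum.tendsto_sum_nat.const_sub (∑' k, γ k * a k ^ 2)
      rwa [sub_self] at h0
    exact eventually_atTop.mp (h1.eventually (gt_mem_nhds (by positivity)))
  obtain ⟨n, hyn, hn⟩ := ((mapClusterPt_iff_frequently.mp hp _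
    (Metric.ball_mem_nhds p (half_pos hε))).and_eventually
      (eventually_ge_atTop (max N M))).exists
  have hnN : N ≤ n := (le_max_left _ _).trans hn
  have hnM : M ≤ n := (le_max_right _ _).trans hn
  have hfin : ∀ m, ε * dist (y (n + m)) (y n) ≤ S (n + m) - S n → dist (y (n + m)) p < ε := by
    intro m h
    have h1 := hM n hnM
    have h2 := hSle (n + m)
    have h3 : dist (y (n + m)) (y n) < ε / 2 := by
      by_contra! h4
      have := mul_le_mul_of_nonneg_left h4 hε.le
      linarith
    have h4 : dist (y n) p < ε / 2 := hyn
    linarith [dist_triangle (y (n + m)) (y n) p]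
  -- Confinement and the displacement bound sustain each other: inside the ball `a ≥ ε`, so `ε γ a ≤
  -- γ a²`, and by `hfin` the bound keeps the iterate in the ball.
  have key : ∀ m, ε * dist (y (n + m)) (y n) ≤ S (n + m) - S n := by
    intro m
    induction m with
    | zero => simp
    | succ m ih =>
      have h1 : ε ≤ a (n + m) := by
        by_contra! h2
        exact hN (n + m) (by omega) ⟨hfin m ih, h2⟩
      have h2 := dist_triangle (y (n + m + 1)) (y (n + m)) (y n)
      rw [hstep] at h2
      have h3 := mul_le_mul_of_nonneg_left h2 hε.le
      have h4 : ε * (γ (n + m) * a (n + m)) ≤ γ (n + m) * a (n + m) ^ 2 := by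
        have := mul_le_mul_of_nonneg_right h1 (mul_nonneg (hγ (n + m)).le (ha (n + m)))
        linarith
      have := hSm (n + m)
      rw [← add_assoc]
      linarith [ih]
  have hbig : ∀ m, n ≤ m → ε ≤ a m := by
    intro m hm
    obtain ⟨q, rfl⟩ := Nat.exists_eq_add_of_le hm
    by_contra! h2
    exact hN (n + q) (by omega) ⟨hfin q (key q), h2⟩
  -- With `a ≥ ε` at all later indices, `ε² ∑ γ` is dominated by a convergent sum.
  have hbound : ∀ m, ε ^ 2 * ∑ k ∈ Finset.range (n + m), γ k ≤
      ε ^ 2 * ∑ k ∈ Finset.range n, γ k + (S (n + m) - S n) := by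
    intro m
    induction m with
    | zero => simp
    | succ m ih =>
      rw [← add_assoc, Finset.sum_range_succ, hSm]
      have h1 := pow_le_pow_left₀ hε.le (hbig (n + m) (by omega)) 2
      have h2 := mul_le_mul_of_nonneg_left h1 (hγ (n + m)).le
      linarith
  obtain ⟨R, hR⟩ := (eventually_atTop.mp (hdiv.eventually_gt_atTop
    ((ε ^ 2 * ∑ k ∈ Finset.range n, γ k + (∑' k, γ k * a k ^ 2 - S n)) / ε ^ 2)))
  have h1 := hR (n + R) (by omega)
  rw [div_lt_iff₀ (by positivity)] at h1
  linarith [hbound R, hSle (n + R)]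

/-- Extraction of a subsequence along which `y` converges to `p` and `a` to zero. -/
theorem exists_subseq_tendsto_of_frequently {E : Type*} [PseudoMetricSpace E] {a : ℕ → ℝ}
    {y : ℕ → E} {p : E} (ha : ∀ k, 0 ≤ a k)
    (h : ∀ ε : ℝ, 0 < ε → ∃ᶠ k in atTop, dist (y k) p < ε ∧ a k < ε) :
    ∃ φ : ℕ → ℕ, StrictMono φ ∧ Tendsto (y ∘ φ) atTop (𝓝 p) ∧ Tendsto (a ∘ φ) atTop (𝓝 0) := by
  obtain ⟨φ, hφ, hlim⟩ := MapClusterPt.tendsto_subseq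
    (u := fun k => (y k, a k)) (x := (p, (0 : ℝ))) (by
      rw [mapClusterPt_iff_frequently]
      intro s hs
      obtain ⟨ε, hε, hball⟩ := Metric.mem_nhds_iff.mp hs
      refine (h ε hε).mono fun k hk => hball ?_
      rw [Metric.mem_ball, Prod.dist_eq, max_lt_iff, Real.dist_0_eq_abs, abs_of_nonneg (ha k)]
      exact hk)
  exact ⟨φ, hφ, (continuous_fst.tendsto _).comp hlim, (continuous_snd.tendsto _).comp hlim⟩

end

/-! ### Partial derivatives and interior KKT points -/

noncomputable section

section PartialDerivatives

variable {E F G : Type*} [NormedAddCommGroup E] [NormedSpace ℝ E] [NormedAddCommGroup F]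
  [NormedSpace ℝ F] [NormedAddCommGroup G] [NormedSpace ℝ G] {φ : E × F → G} {x : E} {y : F}

theorem DifferentiableAt.hasFDerivAt_left (h : DifferentiableAt ℝ φ (x, y)) :
    HasFDerivAt (fun u => φ (u, y)) ((fderiv ℝ φ (x, y)).comp (.inl ℝ E F)) x :=
  h.hasFDerivAt.comp x (hasFDerivAt_prodMk_left x y)

theorem DifferentiableAt.hasFDerivAt_right (h : DifferentiableAt ℝ φ (x, y)) :
    HasFDerivAt (fun u => φ (x, u)) ((fderiv ℝ φ (x, y)).comp (.inr ℝ E F)) y :=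
  h.hasFDerivAt.comp y (hasFDerivAt_prodMk_right x y)

/-- The total derivative is the sum of the partial derivatives. -/
theorem DifferentiableAt.fderiv_eq_add_partial (h : DifferentiableAt ℝ φ (x, y)) (v : E) (w : F) :
    fderiv ℝ φ (x, y) (v, w) =
      fderiv ℝ (fun u => φ (u, y)) x v + fderiv ℝ (fun u => φ (x, u)) y w := by
  rw [h.hasFDerivAt_left.fderiv, h.hasFDerivAt_right.fderiv]
  simp [← map_add]

end PartialDerivatives

namespace NLP

variable {E ι κ : Type} [NormedAddCommGroup E] [NormedSpace ℝ E] [Fintype ι] [Fintype κ]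

theorem lagrangeDeriv_apply (P : NLP E ι κ) (x : E) (μ : ι → ℝ) (lam : κ → ℝ) (v : E) :
    P.lagrangeDeriv x μ lam v = fderiv ℝ P.f x v + ∑ j, μ j * fderiv ℝ (P.g j) x v
      + ∑ l, lam l * fderiv ℝ (P.h l) x v := by
  simp [lagrangeDeriv]

/-- At an interior point the variational inequality says that the derivative of the Lagrangian
vanishes. -/
theorem KKT.lagrangeDeriv_eq_zero {P : NLP E ι κ} {x : E} {μ : ι → ℝ} {lam : κ → ℝ}
    (h : P.KKT x μ lam) (hx : x ∈ interior P.X) : P.lagrangeDeriv x μ lam = 0 := by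
  have hnear : ∀ v, 0 ≤ P.lagrangeDeriv x μ lam v := by
    intro v
    have hc : ContinuousAt (fun t : ℝ => x + t • v) 0 := by fun_prop
    have hev : ∀ᶠ t : ℝ in 𝓝[>] 0, x + t • v ∈ P.X := by
      refine (hc.tendsto.eventually ?_).filter_mono nhdsWithin_le_nhds
      simpa using mem_interior_iff_mem_nhds.mp hx
    obtain ⟨t, ht, ht0⟩ := (hev.and self_mem_nhdsWithin).exists
    have := h.variational _ ht
    rw [add_sub_cancel_left, map_smul, smul_eq_mul] at this
    exact nonneg_of_mul_nonneg_right this ht0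
  ext v
  have := hnear (-v)
  rw [map_neg] at this
  exact le_antisymm (neg_nonneg.mp this) (hnear v)

end NLP

namespace PDProblem

variable {P : PDProblem}

theorem gradDag_apply (i : Fin P.I) (x : P.E i) (y : P.E0) (μt : Fin (P.rt i) → ℝ)
    (lam : Fin (P.mt i) → ℝ) (w : P.E0) :
    P.gradDag i x y μt lam w = fderiv ℝ (fun w => P.f i (x, w)) y w
      + ∑ j, μt j * fderiv ℝ (fun w => P.gt i j (x, w)) y w
      + ∑ l, lam l * fderiv ℝ (fun w => P.ht i l (x, w)) y w := by
  simp [gradDag]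

theorem sub_lagrangeDeriv_apply (i : Fin P.I) (x : P.E i) (y : P.E0) (μt : Fin (P.rt i) → ℝ)
    (μ : Fin (P.r i) → ℝ) (lam : Fin (P.mt i) → ℝ) (v : P.E i) :
    (P.sub i y).lagrangeDeriv x (Sum.elim μt μ) lam v = fderiv ℝ (fun x => P.f i (x, y)) x v
      + (∑ j, μt j * fderiv ℝ (fun x => P.gt i j (x, y)) x v
        + ∑ j, μ j * fderiv ℝ (P.g i j) x v)
      + ∑ l, lam l * fderiv ℝ (fun x => P.ht i l (x, y)) x v := by
  simp only [NLP.lagrangeDeriv_apply, Fintype.sum_sum_type]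
  rfl

namespace Standing

theorem prod_mem_nhds (hP : P.Standing) {i : Fin P.I} {x : P.E i} {y : P.E0} (hx : x ∈ P.U i)
    (hy : y ∈ P.V) : P.U i ×ˢ P.V ∈ 𝓝 (x, y) :=
  ((hP.U_open i).prod hP.V_open).mem_nhds ⟨hx, hy⟩

theorem f_differentiableAt (hP : P.Standing) {i : Fin P.I} {x : P.E i} {y : P.E0}
    (hx : x ∈ P.U i) (hy : y ∈ P.V) : DifferentiableAt ℝ (P.f i) (x, y) :=
  ((hP.f_diff i).contDiffAt (hP.prod_mem_nhds hx hy)).differentiableAt one_ne_zero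

theorem gt_differentiableAt (hP : P.Standing) {i : Fin P.I} {x : P.E i} {y : P.E0}
    (hx : x ∈ P.U i) (hy : y ∈ P.V) (j : Fin (P.rt i)) : DifferentiableAt ℝ (P.gt i j) (x, y) :=
  ((hP.gt_diff i j).contDiffAt (hP.prod_mem_nhds hx hy)).differentiableAt one_ne_zero

theorem ht_differentiableAt (hP : P.Standing) {i : Fin P.I} {x : P.E i} {y : P.E0}
    (hx : x ∈ P.U i) (hy : y ∈ P.V) (l : Fin (P.mt i)) : DifferentiableAt ℝ (P.ht i l) (x, y) :=
  ((hP.ht_diff i l).contDiffAt (hP.prod_mem_nhds hx hy)).differentiableAt one_ne_zero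

theorem g_differentiableAt (hP : P.Standing) {i : Fin P.I} {x : P.E i} (hx : x ∈ P.U i)
    (j : Fin (P.r i)) : DifferentiableAt ℝ (P.g i j) x :=
  ((hP.g_diff i j).contDiffAt ((hP.U_open i).mem_nhds hx)).differentiableAt one_ne_zero

theorem f0_differentiableAt (hP : P.Standing) {y : P.E0} (hy : y ∈ P.V) :
    DifferentiableAt ℝ P.f0 y :=
  (hP.f0_diff.contDiffAt (hP.V_open.mem_nhds hy)).differentiableAt one_ne_zero

theorem g0_differentiableAt (hP : P.Standing) {y : P.E0} (hy : y ∈ P.V) (j : Fin P.r0) :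
    DifferentiableAt ℝ (P.g0 j) y :=
  ((hP.g0_diff j).contDiffAt (hP.V_open.mem_nhds hy)).differentiableAt one_ne_zero

end Standing

/-! ### Splitting the Lagrangian of the coupled problem -/

/-- The projection `(x, y) ↦ (x i, y)`. -/
def blockProj (P : PDProblem) (i : Fin P.I) : ((∀ i, P.E i) × P.E0) →L[ℝ] P.E i × P.E0 :=
  ((ContinuousLinearMap.proj i).comp (.fst ℝ (∀ i, P.E i) P.E0)).prod
    (.snd ℝ (∀ i, P.E i) P.E0)

theorem hasFDerivAt_comp_blockProj {i : Fin P.I} {φ : P.E i × P.E0 → ℝ} {x : ∀ i, P.E i}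
    {y : P.E0} (h : DifferentiableAt ℝ φ (x i, y)) :
    HasFDerivAt (fun z : (∀ i, P.E i) × P.E0 => φ (z.1 i, z.2))
      ((fderiv ℝ φ (x i, y)).comp (P.blockProj i)) (x, y) :=
  HasFDerivAt.comp (x, y) (f := P.blockProj i) h.hasFDerivAt (P.blockProj i).hasFDerivAt

theorem fderiv_comp_blockProj {i : Fin P.I} {φ : P.E i × P.E0 → ℝ} {x : ∀ i, P.E i}
    {y : P.E0} (h : DifferentiableAt ℝ φ (x i, y)) (v : ∀ i, P.E i) (w : P.E0) :
    fderiv ℝ (fun z : (∀ i, P.E i) × P.E0 => φ (z.1 i, z.2)) (x, y) (v, w) =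
      fderiv ℝ (fun u => φ (u, y)) (x i) (v i) + fderiv ℝ (fun u => φ (x i, u)) y w := by
  rw [(hasFDerivAt_comp_blockProj h).fderiv, ← h.fderiv_eq_add_partial]
  rfl

/-- The Lagrangian derivative of the whole problem splits into those of the subproblems and
a part in the direction of `y`. -/
theorem Standing.full_lagrangeDeriv_apply (hP : P.Standing) {x : ∀ i, P.E i} {y : P.E0}
    (hx : ∀ i, x i ∈ P.U i) (hy : y ∈ P.V) (μt : ∀ i, Fin (P.rt i) → ℝ)
    (lam : ∀ i, Fin (P.mt i) → ℝ) (μ : ∀ i, Fin (P.r i) → ℝ) (μ0 : Fin P.r0 → ℝ)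
    (v : ∀ i, P.E i) (w : P.E0) :
    P.full.lagrangeDeriv (x, y)
        (Sum.elim (fun s => μt s.1 s.2) (Sum.elim (fun s => μ s.1 s.2) μ0))
        (fun s => lam s.1 s.2) (v, w) =
      ∑ i, (P.sub i y).lagrangeDeriv (x i) (Sum.elim (μt i) (μ i)) (lam i) (v i)
      + ((fderiv ℝ P.f0 y + ∑ i, P.gradDag i (x i) y (μt i) (lam i)) w
        + ∑ j, μ0 j * fderiv ℝ (P.g0 j) y w) := by
  have hsnd : ∀ {φ : P.E0 → ℝ}, DifferentiableAt ℝ φ y →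
      HasFDerivAt (fun z : (∀ i, P.E i) × P.E0 => φ z.2)
        ((fderiv ℝ φ y).comp (.snd ℝ (∀ i, P.E i) P.E0)) (x, y) := fun h =>
    HasFDerivAt.comp (x, y) (f := Prod.snd) h.hasFDerivAt hasFDerivAt_snd
  have hf : fderiv ℝ P.full.f (x, y) (v, w) = fderiv ℝ P.f0 y w +
      ∑ i, (fderiv ℝ (fun u => P.f i (u, y)) (x i) (v i)
        + fderiv ℝ (fun u => P.f i (x i, u)) y w) := by
    have h := (hsnd (hP.f0_differentiableAt hy)).add (HasFDerivAt.fun_sum (u := Finset.univ)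
      fun i _ => hasFDerivAt_comp_blockProj (hP.f_differentiableAt (hx i) hy))
    have h' : fderiv ℝ P.full.f (x, y) = _ := h.fderiv
    rw [h']
    simp only [add_apply, sum_apply]
    congr 1
    refine Finset.sum_congr rfl fun i _ => ?_
    rw [← (hP.f_differentiableAt (hx i) hy).fderiv_eq_add_partial]
    rfl
  have hgt : ∀ s : Σ i, Fin (P.rt i), fderiv ℝ (P.full.g (Sum.inl s)) (x, y) (v, w) =
      fderiv ℝ (fun u => P.gt s.1 s.2 (u, y)) (x s.1) (v s.1)
        + fderiv ℝ (fun u => P.gt s.1 s.2 (x s.1, u)) y w := fun s =>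
    fderiv_comp_blockProj (hP.gt_differentiableAt (hx s.1) hy s.2) v w
  have hht : ∀ s : Σ i, Fin (P.mt i), fderiv ℝ (P.full.h s) (x, y) (v, w) =
      fderiv ℝ (fun u => P.ht s.1 s.2 (u, y)) (x s.1) (v s.1)
        + fderiv ℝ (fun u => P.ht s.1 s.2 (x s.1, u)) y w := fun s =>
    fderiv_comp_blockProj (hP.ht_differentiableAt (hx s.1) hy s.2) v w
  have hg : ∀ s : Σ i, Fin (P.r i), fderiv ℝ (P.full.g (Sum.inr (Sum.inl s))) (x, y) (v, w) =
      fderiv ℝ (P.g s.1 s.2) (x s.1) (v s.1) := fun s => by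
    have h : HasFDerivAt (P.full.g (Sum.inr (Sum.inl s))) _ (x, y) :=
      HasFDerivAt.comp (x, y) (g := P.g s.1 s.2)
        (f := (ContinuousLinearMap.proj s.1).comp (.fst ℝ (∀ i, P.E i) P.E0))
        (hP.g_differentiableAt (hx s.1) s.2).hasFDerivAt (ContinuousLinearMap.hasFDerivAt _)
    rw [h.fderiv]
    rfl
  have hg0 : ∀ j, fderiv ℝ (P.full.g (Sum.inr (Sum.inr j))) (x, y) (v, w) =
      fderiv ℝ (P.g0 j) y w := fun j => by
    have h : HasFDerivAt (P.full.g (Sum.inr (Sum.inr j))) _ (x, y) :=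
      hsnd (hP.g0_differentiableAt hy j)
    rw [h.fderiv]
    rfl
  rw [NLP.lagrangeDeriv_apply, Fintype.sum_sum_type, Fintype.sum_sum_type]
  simp only [hf, hgt, hht, hg, hg0, Sum.elim_inl, Sum.elim_inr, add_apply, sum_apply,
    sub_lagrangeDeriv_apply, gradDag_apply, Fintype.sum_sigma, mul_add, Finset.sum_add_distrib]
  ring

/-! ### The envelope theorem along a branch -/

namespace IsStationaryBranch

variable {D : Set P.E0} {B : P.Branch}

theorem mem_U (hP : P.Standing) (hB : P.IsStationaryBranch D B) (i : Fin P.I) {y : P.E0}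
    (hy : y ∈ D) : B.X i y ∈ P.U i :=
  hP.X_subset i (interior_subset (hB.interior i y hy))

theorem X_differentiableAt (hB : P.IsStationaryBranch D B) (i : Fin P.I) {y : P.E0}
    (hy : y ∈ D) : DifferentiableAt ℝ (B.X i) y :=
  ((hB.X_diff i).contDiffAt (hB.D_open.mem_nhds hy)).differentiableAt one_ne_zero

/-- The chain rule along the graph of a branch. -/
theorem hasFDerivAt_comp (hB : P.IsStationaryBranch D B) (i : Fin P.I) {y : P.E0} (hy : y ∈ D)
    {φ : P.E i × P.E0 → ℝ} (hφ : DifferentiableAt ℝ φ (B.X i y, y)) :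
    HasFDerivAt (fun w => φ (B.X i w, w)) ((fderiv ℝ φ (B.X i y, y)).comp
      ((fderiv ℝ (B.X i) y).prod (.id ℝ P.E0))) y :=
  HasFDerivAt.comp y (f := fun w => (B.X i w, w)) hφ.hasFDerivAt
    ((hB.X_differentiableAt i hy).hasFDerivAt.prodMk (hasFDerivAt_id y))

/-- The partial derivatives cancel along the branch for a function that has a local maximum. -/
theorem partial_add_eq_zero (hB : P.IsStationaryBranch D B) (i : Fin P.I) {y : P.E0} (hy : y ∈ D)
    {φ : P.E i × P.E0 → ℝ} (hφ : DifferentiableAt ℝ φ (B.X i y, y))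
    (hmax : IsLocalMax (fun w => φ (B.X i w, w)) y) (w : P.E0) :
    fderiv ℝ (fun u => φ (u, y)) (B.X i y) (fderiv ℝ (B.X i) y w)
      + fderiv ℝ (fun u => φ (B.X i y, u)) y w = 0 := by
  rw [← hφ.fderiv_eq_add_partial]
  have h := hmax.fderiv_eq_zero
  rw [(hB.hasFDerivAt_comp i hy hφ).fderiv] at h
  exact DFunLike.congr_fun h w

/-- The envelope theorem along a stationary branch. -/
theorem hasFDerivAt_fDag (hP : P.Standing) (hB : P.IsStationaryBranch D B) {y : P.E0}
    (hy : y ∈ D) :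
    HasFDerivAt (P.fDag B.X)
      (fderiv ℝ P.f0 y + ∑ i, P.gradDag i (B.X i y) y (B.Mt i y) (B.Lt i y)) y := by
  have hyV : y ∈ P.V := (hB.D_subset hy).1
  have hD := hB.D_open.mem_nhds hy
  have key : ∀ i, HasFDerivAt (fun w => P.f i (B.X i w, w))
      (P.gradDag i (B.X i y) y (B.Mt i y) (B.Lt i y)) y := by
    intro i
    have hU := hB.mem_U hP i hy
    have hK := hB.kkt i y hy
    have hdf := hP.f_differentiableAt hU hyV
    convert! hB.hasFDerivAt_comp i hy hdf using 1
    ext w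
    have hL := DFunLike.congr_fun (hK.lagrangeDeriv_eq_zero (hB.interior i y hy))
      (fderiv ℝ (B.X i) y w)
    rw [sub_lagrangeDeriv_apply, zero_apply] at hL
    -- A constraint with nonzero multiplier is zero at `y` and nonpositive along the branch, so it
    -- has a local maximum there and its total derivative vanishes. No constancy of the active set
    -- is required.
    have hgt : ∑ j, B.Mt i y j * fderiv ℝ (fun x => P.gt i j (x, y)) (B.X i y)
          (fderiv ℝ (B.X i) y w)
        + ∑ j, B.Mt i y j * fderiv ℝ (fun u => P.gt i j (B.X i y, u)) y w = 0 := by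
      rw [← Finset.sum_add_distrib]
      refine Finset.sum_eq_zero fun j _ => ?_
      rw [← mul_add]
      rcases mul_eq_zero.mp (hK.complementary (Sum.inl j)) with h0 | h0
      · rw [show B.Mt i y j = 0 from h0, zero_mul]
      · rw [hB.partial_add_eq_zero i hy (hP.gt_differentiableAt hU hyV j), mul_zero]
        filter_upwards [hD] with w hw
        rw [show P.gt i j (B.X i y, y) = 0 from h0]
        exact (hB.kkt i w hw).feasible.2.1 (Sum.inl j)
    have hg : ∑ j, B.M i y j * fderiv ℝ (P.g i j) (B.X i y) (fderiv ℝ (B.X i) y w) = 0 := by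
      refine Finset.sum_eq_zero fun j _ => ?_
      rcases mul_eq_zero.mp (hK.complementary (Sum.inr j)) with h0 | h0
      · rw [show B.M i y j = 0 from h0, zero_mul]
      · have hc : HasFDerivAt (fun w => P.g i j (B.X i w)) _ y :=
          HasFDerivAt.comp y (hP.g_differentiableAt hU j).hasFDerivAt
            (hB.X_differentiableAt i hy).hasFDerivAt
        have hmax : IsLocalMax (fun w => P.g i j (B.X i w)) y := by
          filter_upwards [hD] with w hw
          rw [show P.g i j (B.X i y) = 0 from h0]
          exact (hB.kkt i w hw).feasible.2.1 (Sum.inr j)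
        have := DFunLike.congr_fun (hmax.hasFDerivAt_eq_zero hc) w
        rw [show fderiv ℝ (P.g i j) (B.X i y) (fderiv ℝ (B.X i) y w) = 0 from this, mul_zero]
    -- Equality constraints vanish identically along the branch, which is a trivial local maximum.
    have hht : ∑ l, B.Lt i y l * fderiv ℝ (fun x => P.ht i l (x, y)) (B.X i y)
          (fderiv ℝ (B.X i) y w)
        + ∑ l, B.Lt i y l * fderiv ℝ (fun u => P.ht i l (B.X i y, u)) y w = 0 := by
      rw [← Finset.sum_add_distrib]
      refine Finset.sum_eq_zero fun l _ => ?_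
      rw [← mul_add, hB.partial_add_eq_zero i hy (hP.ht_differentiableAt hU hyV l), mul_zero]
      filter_upwards [hD] with w hw
      rw [show P.ht i l (B.X i y, y) = 0 from hK.feasible.2.2 l]
      exact ((hB.kkt i w hw).feasible.2.2 l).le
    have hf := hdf.fderiv_eq_add_partial (fderiv ℝ (B.X i) y w) w
    change _ = fderiv ℝ (P.f i) (B.X i y, y) (fderiv ℝ (B.X i) y w, w)
    rw [hf, gradDag_apply]
    linarith
  exact (hP.f0_differentiableAt hyV).hasFDerivAt.add
    (HasFDerivAt.fun_sum (u := Finset.univ) fun i _ => key i)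

/-- A stationary point of the master problem formed with a branch gives a stationary point of the
whole problem. -/
theorem full_isStationary (hP : P.Standing) (hB : P.IsStationaryBranch D B) {y : P.E0}
    (hy : y ∈ D) (hs : (P.master B.X).IsStationary y) :
    P.full.IsStationary (fun i => B.X i y, y) := by
  obtain ⟨μ0, lam0, h⟩ := hs
  refine ⟨Sum.elim (fun s => B.Mt s.1 y s.2) (Sum.elim (fun s => B.M s.1 y s.2) μ0),
    fun s => B.Lt s.1 y s.2, ?_, ?_, ?_, ?_, ?_, ?_⟩
  · rintro ⟨x', y'⟩ ⟨hx', hy'⟩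
    rw [Prod.mk_sub_mk, hP.full_lagrangeDeriv_apply (fun i => hB.mem_U hP i hy)
      (hB.D_subset hy).1 (fun i => B.Mt i y) (fun i => B.Lt i y) (fun i => B.M i y) μ0]
    refine add_nonneg (Finset.sum_nonneg fun i _ => (hB.kkt i y hy).variational _ (hx' i)) ?_
    have := h.variational y' hy'
    rw [NLP.lagrangeDeriv_apply, Fin.sum_univ_zero, add_zero] at this
    change 0 ≤ fderiv ℝ (P.fDag B.X) y _ + ∑ j, μ0 j * fderiv ℝ (P.g0 j) y _ at this
    rwa [(hB.hasFDerivAt_fDag hP hy).fderiv] at this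
  · rintro (s | s | j)
    · exact (hB.kkt s.1 y hy).complementary (Sum.inl s.2)
    · exact (hB.kkt s.1 y hy).complementary (Sum.inr s.2)
    · exact h.complementary j
  · rintro (s | s | j)
    · exact (hB.kkt s.1 y hy).nonneg (Sum.inl s.2)
    · exact (hB.kkt s.1 y hy).nonneg (Sum.inr s.2)
    · exact h.nonneg j
  · exact ⟨fun i => (hB.kkt i y hy).feasible.1, h.feasible.1⟩
  · rintro (s | s | j)
    · exact (hB.kkt s.1 y hy).feasible.2.1 (Sum.inl s.2)
    · exact (hB.kkt s.1 y hy).feasible.2.1 (Sum.inr s.2)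
    · exact h.feasible.2.1 j
  · exact fun s => (hB.kkt s.1 y hy).feasible.2.2 s.2

end IsStationaryBranch

/-- The blocks of a stationary point of the whole problem are stationary for the subproblems. -/
theorem sub_kkt_of_full_kkt (hP : P.Standing) {x : ∀ i, P.E i} {y : P.E0}
    {μt : ∀ i, Fin (P.rt i) → ℝ} {lam : ∀ i, Fin (P.mt i) → ℝ} {μ : ∀ i, Fin (P.r i) → ℝ}
    {μ0 : Fin P.r0 → ℝ}
    (h : P.full.KKT (x, y) (Sum.elim (fun s => μt s.1 s.2) (Sum.elim (fun s => μ s.1 s.2) μ0))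
      (fun s => lam s.1 s.2)) (i : Fin P.I) :
    (P.sub i y).KKT (x i) (Sum.elim (μt i) (μ i)) (lam i) := by
  have hX : ∀ i, x i ∈ P.X i := h.feasible.1.1
  have hY : y ∈ P.Y := h.feasible.1.2
  refine ⟨fun x' hx' => ?_, ?_, ?_, hX i, ?_, fun l => h.feasible.2.2 ⟨i, l⟩⟩
  -- Varying block `i` alone removes the other blocks and the `y`-part from the split Lagrangian
  -- derivative.
  · have := h.variational (Function.update x i x', y) ⟨fun j => by
      by_cases hj : j = i
      · subst hj; simp only [Function.update_self]; exact hx'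
      · simpa [hj] using hX j, hY⟩
    rw [Prod.mk_sub_mk, hP.full_lagrangeDeriv_apply (fun i => hP.X_subset i (hX i))
      (hP.Y_subset hY), sub_self, Finset.sum_eq_single i] at this
    · simpa using this
    · intro j _ hj
      simp [hj]
    · simp
  · rintro (j | j)
    · exact h.complementary (Sum.inl ⟨i, j⟩)
    · exact h.complementary (Sum.inr (Sum.inl ⟨i, j⟩))
  · rintro (j | j)
    · exact h.nonneg (Sum.inl ⟨i, j⟩)
    · exact h.nonneg (Sum.inr (Sum.inl ⟨i, j⟩))
  · rintro (j | j)
    · exact h.feasible.2.1 (Sum.inl ⟨i, j⟩)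
    · exact h.feasible.2.1 (Sum.inr (Sum.inl ⟨i, j⟩))

end PDProblem

end

/-! ### The KKT system and the implicit function theorem -/

noncomputable section

namespace NLP

variable {E ι κ : Type} [NormedAddCommGroup E] [NormedSpace ℝ E] [Fintype ι] [Fintype κ]

/-- Near a strictly complementary point, the KKT conditions say that the KKT function vanishes. -/
theorem kkt_iff_kktFun_eq_zero (P : NLP E ι κ) {A : Set ι} {z : E × (ι → ℝ) × (κ → ℝ)}
    (hz : z.1 ∈ interior P.X) (hA : ∀ j ∈ A, 0 < z.2.1 j) (hA' : ∀ j ∉ A, P.g j z.1 < 0) :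
    P.KKT z.1 z.2.1 z.2.2 ↔ P.kktFun A z = 0 := by
  constructor
  · intro h
    refine Prod.ext (h.lagrangeDeriv_eq_zero hz) (Prod.ext (funext fun j => ?_)
      (funext h.feasible.2.2))
    by_cases hj : j ∈ A
    · simpa [kktFun, hj] using (mul_eq_zero.mp (h.complementary j)).resolve_left (hA j hj).ne'
    · simpa [kktFun, hj] using (mul_eq_zero.mp (h.complementary j)).resolve_right (hA' j hj).ne
  · intro h
    have h1 : P.lagrangeDeriv z.1 z.2.1 z.2.2 = 0 := congrArg Prod.fst h
    have h2 : ∀ j, (P.kktFun A z).2.1 j = 0 := fun j => by rw [h]; rfl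
    have hin : ∀ j ∈ A, P.g j z.1 = 0 := fun j hj => by simpa [kktFun, hj] using h2 j
    have hout : ∀ j ∉ A, z.2.1 j = 0 := fun j hj => by simpa [kktFun, hj] using h2 j
    refine ⟨fun x' _ => by rw [h1]; simp, fun j => ?_, fun j => ?_, interior_subset hz,
      fun j => ?_, fun l => congrFun (congrArg (fun p => p.2.2) h) l⟩
    · by_cases hj : j ∈ A
      · rw [hin j hj, mul_zero]
      · rw [hout j hj, zero_mul]
    · by_cases hj : j ∈ A
      · exact (hA j hj).le
      · exact (hout j hj).ge
    · by_cases hj : j ∈ A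
      · exact (hin j hj).le
      · exact (hA' j hj).le

variable {F : Type} [NormedAddCommGroup F] [NormedSpace ℝ F]

/-- The KKT function of a `C²` family of programs is `C¹` in all its variables. -/
theorem contDiffAt_kktFun {Q : F → NLP E ι κ} {y₀ : F} {z₀ : E × (ι → ℝ) × (κ → ℝ)} (A : Set ι)
    (hf : ContDiffAt ℝ 2 (fun p : F × E => (Q p.1).f p.2) (y₀, z₀.1))
    (hg : ∀ j, ContDiffAt ℝ 2 (fun p : F × E => (Q p.1).g j p.2) (y₀, z₀.1))
    (hh : ∀ l, ContDiffAt ℝ 2 (fun p : F × E => (Q p.1).h l p.2) (y₀, z₀.1)) :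
    ContDiffAt ℝ 1 (fun p : F × E × (ι → ℝ) × (κ → ℝ) => (Q p.1).kktFun A p.2) (y₀, z₀) := by
  have hfst : ContDiffAt ℝ 1 (fun p : F × E × (ι → ℝ) × (κ → ℝ) => (p.1, p.2.1)) (y₀, z₀) := by
    fun_prop
  have hderiv : ∀ u : F → E → ℝ, ContDiffAt ℝ 2 (fun p : F × E => u p.1 p.2) (y₀, z₀.1) →
      ContDiffAt ℝ 1 (fun p : F × E × (ι → ℝ) × (κ → ℝ) => fderiv ℝ (u p.1) p.2.1) (y₀, z₀) := by
    intro u hu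
    -- Differentiating in `x` with the remaining variables as parameters costs one order of
    -- smoothness, whence `C²` data for a `C¹` system.
    refine ContDiffAt.fderiv (f := fun p : F × E × (ι → ℝ) × (κ → ℝ) => u p.1)
      (g := fun p => p.2.1) (n := 2) ?_ (by fun_prop) (by norm_num)
    exact ContDiffAt.comp ((y₀, z₀), z₀.1)
      (f := fun q : (F × E × (ι → ℝ) × (κ → ℝ)) × E => (q.1.1, q.2)) hu (by fun_prop)
  have hval : ∀ u : F → E → ℝ, ContDiffAt ℝ 2 (fun p : F × E => u p.1 p.2) (y₀, z₀.1) →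
      ContDiffAt ℝ 1 (fun p : F × E × (ι → ℝ) × (κ → ℝ) => u p.1 p.2.1) (y₀, z₀) := fun u hu =>
    ContDiffAt.comp (y₀, z₀) (g := fun p : F × E => u p.1 p.2) (hu.of_le (by norm_num)) hfst
  refine ContDiffAt.prodMk ?_ (ContDiffAt.prodMk ?_ ?_)
  · refine ((hderiv (fun y => (Q y).f) hf).add (ContDiffAt.sum fun j _ => ?_)).add
      (ContDiffAt.sum fun l _ => ?_)
    · exact ContDiffAt.smul (f := fun p : F × E × (ι → ℝ) × (κ → ℝ) => p.2.2.1 j) (by fun_prop)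
        (hderiv (fun y => (Q y).g j) (hg j))
    · exact ContDiffAt.smul (f := fun p : F × E × (ι → ℝ) × (κ → ℝ) => p.2.2.2 l) (by fun_prop)
        (hderiv (fun y => (Q y).h l) (hh l))
  · refine contDiffAt_pi.mpr fun j => ?_
    by_cases hj : j ∈ A
    · simpa only [hj, if_true] using hval (fun y => (Q y).g j) (hg j)
    · simp only [hj, if_false]
      fun_prop
  · exact contDiffAt_pi.mpr fun l => hval (fun y => (Q y).h l) (hh l)

/-- Local solvability of the KKT conditions of a parametric family of programs near a nondegenerate
interior stationary point. -/
theorem exists_local_kkt_branch [CompleteSpace E] [CompleteSpace F] {Q : F → NLP E ι κ} {X : Set E}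
    (hX : ∀ y, (Q y).X = X) {y₀ : F} {z₀ : E × (ι → ℝ) × (κ → ℝ)}
    (hf : ContDiffAt ℝ 2 (fun p : F × E => (Q p.1).f p.2) (y₀, z₀.1))
    (hg : ∀ j, ContDiffAt ℝ 2 (fun p : F × E => (Q p.1).g j p.2) (y₀, z₀.1))
    (hh : ∀ l, ContDiffAt ℝ 2 (fun p : F × E => (Q p.1).h l p.2) (y₀, z₀.1))
    (hint : z₀.1 ∈ interior X) (hkkt : (Q y₀).KKT z₀.1 z₀.2.1 z₀.2.2)
    (hstrict : ∀ j, (Q y₀).g j z₀.1 = 0 → 0 < z₀.2.1 j)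
    (hinv : (fderiv ℝ ((Q y₀).kktFun ((Q y₀).activeSet z₀.1)) z₀).IsInvertible) :
    ∃ φ : F → E × (ι → ℝ) × (κ → ℝ), ContDiffAt ℝ 1 φ y₀ ∧ φ y₀ = z₀ ∧
      (∀ᶠ y in 𝓝 y₀, (φ y).1 ∈ interior X ∧ (Q y).KKT (φ y).1 (φ y).2.1 (φ y).2.2) ∧
      ∀ᶠ p in 𝓝 (y₀, z₀), (Q p.1).KKT p.2.1 p.2.2.1 p.2.2.2 → p.2 = φ p.1 := by
  -- The active set is frozen at the base point, so that `Ψ` does not switch between equations as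
  -- `y` varies.
  set A := (Q y₀).activeSet z₀.1 with hA
  set Ψ : F × E × (ι → ℝ) × (κ → ℝ) → (E →L[ℝ] ℝ) × (ι → ℝ) × (κ → ℝ) :=
    fun p => (Q p.1).kktFun A p.2 with hΨ
  have hC : ContDiffAt ℝ 1 Ψ (y₀, z₀) := contDiffAt_kktFun A hf hg hh
  have hinv' : (fderiv ℝ Ψ (y₀, z₀) ∘L .inr ℝ F (E × (ι → ℝ) × (κ → ℝ))).IsInvertible := by
    rw [← (hC.differentiableAt one_ne_zero).hasFDerivAt_right.fderiv]
    exact hinv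
  have hiff : ∀ᶠ p in 𝓝 (y₀, z₀), p.2.1 ∈ interior X ∧
      ((Q p.1).KKT p.2.1 p.2.2.1 p.2.2.2 ↔ Ψ p = 0) := by
    have h1 : ∀ᶠ p in 𝓝 (y₀, z₀), p.2.1 ∈ interior X := by
      have : ContinuousAt (fun p : F × E × (ι → ℝ) × (κ → ℝ) => p.2.1) (y₀, z₀) := by fun_prop
      exact this.eventually_mem (isOpen_interior.mem_nhds hint)
    have h2 : ∀ᶠ p in 𝓝 (y₀, z₀), ∀ j ∈ A, 0 < p.2.2.1 j := by
      refine eventually_all.mpr fun j => ?_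
      by_cases hj : j ∈ A
      · have : ContinuousAt (fun p : F × E × (ι → ℝ) × (κ → ℝ) => p.2.2.1 j) (y₀, z₀) := by
          fun_prop
        exact (this.eventually_mem (lt_mem_nhds (hstrict j hj))).mono fun p hp _ => hp
      · exact Eventually.of_forall fun p h => absurd h hj
    have h3 : ∀ᶠ p in 𝓝 (y₀, z₀), ∀ j ∉ A, (Q p.1).g j p.2.1 < 0 := by
      refine eventually_all.mpr fun j => ?_
      by_cases hj : j ∈ A
      · exact Eventually.of_forall fun p h => absurd hj h
      · have hc : ContinuousAt (fun p : F × E × (ι → ℝ) × (κ → ℝ) => (Q p.1).g j p.2.1)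
            (y₀, z₀) :=
          ContinuousAt.comp (f := fun p : F × E × (ι → ℝ) × (κ → ℝ) => (p.1, p.2.1))
            (g := fun p : F × E => (Q p.1).g j p.2) (hg j).continuousAt (by fun_prop)
        exact (hc.eventually_mem (gt_mem_nhds (lt_of_le_of_ne (hkkt.feasible.2.1 j) hj))).mono
          fun p hp _ => hp
    filter_upwards [h1, h2, h3] with p hp1 hp2 hp3
    exact ⟨hp1, kkt_iff_kktFun_eq_zero _ (by rwa [hX]) hp2 hp3⟩
  have hzero : Ψ (y₀, z₀) = 0 := hiff.self_of_nhds.2.mp hkkt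
  set φ := hC.implicitFunction one_ne_zero hinv' with hφ
  have hφ0 : φ y₀ = z₀ := hC.implicitFunction_apply_self one_ne_zero hinv'
  have hφC : ContDiffAt ℝ 1 φ y₀ := hC.contDiffAt_implicitFunction one_ne_zero hinv'
  refine ⟨φ, hφC, hφ0, ?_, ?_⟩
  · have ht : Tendsto (fun y => (y, φ y)) (𝓝 y₀) (𝓝 (y₀, z₀)) := by
      have := (continuousAt_id (x := y₀)).prodMk hφC.continuousAt
      rwa [ContinuousAt, hφ0] at this
    filter_upwards [ht.eventually hiff, hC.eventually_apply_implicitFunction one_ne_zero hinv']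
      with y h1 h2
    exact ⟨h1.1, h1.2.mpr (h2.trans hzero)⟩
  · filter_upwards [hiff, hC.eventually_apply_eq_iff_implicitFunction one_ne_zero hinv']
      with p h1 h2 hK
    exact (h2.mp ((h1.2.mp hK).trans hzero.symm)).symm

end NLP

namespace PDProblem

variable {P : PDProblem} {xd : ∀ i, P.E i} {yd : P.E0} {μtd : ∀ i, Fin (P.rt i) → ℝ}
  {lamd : ∀ i, Fin (P.mt i) → ℝ} {μd : ∀ i, Fin (P.r i) → ℝ}

theorem Nondegenerate.mem_Y (hnd : P.Nondegenerate xd yd μtd lamd μd) : yd ∈ P.Y :=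
  hnd.stationary.choose_spec.feasible.1.2

/-- The block multipliers of the whole problem already solve the subproblem (`sub_kkt_of_full_kkt`),
so the parametric result applies with `y` as parameter, once the order of the variables is swapped.
-/
theorem Nondegenerate.exists_local_kkt_branch (hP : P.Standing)
    (hnd : P.Nondegenerate xd yd μtd lamd μd) (i : Fin P.I) :
    ∃ φ : P.E0 → P.E i × (Fin (P.rt i) ⊕ Fin (P.r i) → ℝ) × (Fin (P.mt i) → ℝ),
      ContDiffAt ℝ 1 φ yd ∧ φ yd = (xd i, Sum.elim (μtd i) (μd i), lamd i) ∧
      (∀ᶠ y in 𝓝 yd, (φ y).1 ∈ _root_.interior (P.X i) ∧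
        (P.sub i y).KKT (φ y).1 (φ y).2.1 (φ y).2.2) ∧
      ∀ᶠ p in 𝓝 (yd, (xd i, Sum.elim (μtd i) (μd i), lamd i)),
        (P.sub i p.1).KKT p.2.1 p.2.2.1 p.2.2.2 → p.2 = φ p.1 := by
  obtain ⟨μ0, hstat⟩ := hnd.stationary
  have hU : xd i ∈ P.U i := hP.X_subset i (interior_subset (hnd.interior i))
  have hnhds := hP.prod_mem_nhds hU (hP.Y_subset hnd.mem_Y)
  have hswap : ∀ {u : P.E i × P.E0 → ℝ}, ContDiffOn ℝ 2 u (P.U i ×ˢ P.V) →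
      ContDiffAt ℝ 2 (fun p : P.E0 × P.E i => u (p.2, p.1)) (yd, xd i) := fun hu =>
    ContDiffAt.comp (yd, xd i) (f := fun p : P.E0 × P.E i => (p.2, p.1))
      (hu.contDiffAt hnhds) (by fun_prop)
  refine NLP.exists_local_kkt_branch (Q := P.sub i) (fun _ => rfl) (hswap (hnd.f_diff2 i)) ?_
    (fun l => hswap (hnd.ht_diff2 i l)) (hnd.interior i) (sub_kkt_of_full_kkt hP hstat i) ?_
    (hnd.invertible i)
  · rintro (j | j)
    · exact hswap (hnd.gt_diff2 i j)
    · exact ContDiffAt.comp (yd, xd i) (f := fun p : P.E0 × P.E i => p.2)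
        ((hnd.g_diff2 i j).contDiffAt ((hP.U_open i).mem_nhds hU)) (by fun_prop)
  · rintro (j | j)
    · exact hnd.strict_gt i j
    · exact hnd.strict_g i j

/-- A stationary branch through a nondegenerate point, locally unique. -/
theorem Nondegenerate.exists_stationaryBranch (hP : P.Standing)
    (hnd : P.Nondegenerate xd yd μtd lamd μd) :
    ∃ (D : Set P.E0) (B : P.Branch) (Nx : ∀ i, Set (P.E i))
      (Nμt : ∀ i, Set (Fin (P.rt i) → ℝ)) (Nlam : ∀ i, Set (Fin (P.mt i) → ℝ))
      (Nμ : ∀ i, Set (Fin (P.r i) → ℝ)),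
      yd ∈ D ∧ (∀ i, Nx i ∈ 𝓝 (xd i)) ∧ (∀ i, Nμt i ∈ 𝓝 (μtd i)) ∧
      (∀ i, Nlam i ∈ 𝓝 (lamd i)) ∧ (∀ i, Nμ i ∈ 𝓝 (μd i)) ∧
      P.IsStationaryBranch D B ∧ B.PassesThrough xd yd μtd lamd μd ∧
      ∀ᶠ y in 𝓝 yd, ∀ i,
        (B.X i y ∈ Nx i ∧ B.Mt i y ∈ Nμt i ∧ B.Lt i y ∈ Nlam i ∧ B.M i y ∈ Nμ i) ∧
        ∀ x ∈ Nx i, ∀ μt ∈ Nμt i, ∀ lam ∈ Nlam i, ∀ μ ∈ Nμ i,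
          (P.sub i y).KKT x (Sum.elim μt μ) lam →
          x = B.X i y ∧ μt = B.Mt i y ∧ lam = B.Lt i y ∧ μ = B.M i y := by
  choose φ hφC hφ0 hφK hφU using hnd.exists_local_kkt_branch hP
  choose ε hε hball using fun i => Metric.eventually_nhds_iff.mp (hφU i)
  let B : P.Branch :=
    { X := fun i y => (φ i y).1
      Mt := fun i y j => (φ i y).2.1 (Sum.inl j)
      Lt := fun i y => (φ i y).2.2
      M := fun i y j => (φ i y).2.1 (Sum.inr j) }
  have hXc : ∀ {i y}, ContDiffAt ℝ 1 (φ i) y → ContDiffAt ℝ 1 (B.X i) y := fun h => by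
    simp only [B]; fun_prop
  have hMtc : ∀ {i y}, ContDiffAt ℝ 1 (φ i) y → ContDiffAt ℝ 1 (B.Mt i) y := fun h => by
    simp only [B]; fun_prop
  have hLtc : ∀ {i y}, ContDiffAt ℝ 1 (φ i) y → ContDiffAt ℝ 1 (B.Lt i) y := fun h => by
    simp only [B]; fun_prop
  have hMc : ∀ {i y}, ContDiffAt ℝ 1 (φ i) y → ContDiffAt ℝ 1 (B.M i) y := fun h => by
    simp only [B]; fun_prop
  have hpass : B.PassesThrough xd yd μtd lamd μd := fun i => by
    simp [B, hφ0]
  -- Being `C¹` at `yd` spreads to a neighbourhood; the interior of the set of good `y` will serve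
  -- as `D`.
  have hgood : ∀ᶠ y in 𝓝 yd, y ∈ P.V ∧ ∀ i, ContDiffAt ℝ 1 (φ i) y ∧
      (φ i y).1 ∈ _root_.interior (P.X i) ∧ (P.sub i y).KKT (φ i y).1 (φ i y).2.1 (φ i y).2.2 :=
    (hP.V_open.eventually_mem (hP.Y_subset hnd.mem_Y)).and <| eventually_all.mpr fun i =>
      ((hφC i).eventually (by simp)).and (hφK i)
  have hgood' := fun y (hy : y ∈ _root_.interior {y | y ∈ P.V ∧ ∀ i, ContDiffAt ℝ 1 (φ i) y ∧
      (φ i y).1 ∈ _root_.interior (P.X i) ∧ (P.sub i y).KKT (φ i y).1 (φ i y).2.1 (φ i y).2.2}) =>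
    interior_subset hy
  have helim : ∀ i y, Sum.elim (B.Mt i y) (B.M i y) = (φ i y).2.1 := fun i y => by
    funext j
    rcases j with j | j <;> rfl
  refine ⟨_, B, fun i => Metric.ball (xd i) (ε i), fun i => Metric.ball (μtd i) (ε i),
    fun i => Metric.ball (lamd i) (ε i), fun i => Metric.ball (μd i) (ε i),
    mem_interior_iff_mem_nhds.mpr hgood, fun i => Metric.ball_mem_nhds _ (hε i),
    fun i => Metric.ball_mem_nhds _ (hε i), fun i => Metric.ball_mem_nhds _ (hε i),
    fun i => Metric.ball_mem_nhds _ (hε i), ?_, hpass, ?_⟩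
  · refine ⟨isOpen_interior, fun y hy => ⟨(hgood' y hy).1, fun i =>
      ⟨_, ((hgood' y hy).2 i).2.2.feasible⟩⟩,
      fun i y hy => (hXc ((hgood' y hy).2 i).1).contDiffWithinAt,
      fun i y hy => (hMtc ((hgood' y hy).2 i).1).contDiffWithinAt,
      fun i y hy => (hLtc ((hgood' y hy).2 i).1).contDiffWithinAt,
      fun i y hy => (hMc ((hgood' y hy).2 i).1).contDiffWithinAt,
      fun i y hy => ((hgood' y hy).2 i).2.1, fun i y hy => ?_⟩
    rw [helim]
    exact ((hgood' y hy).2 i).2.2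
  · refine eventually_all.mpr fun i => ?_
    have hnear : ∀ {Z : Type} [PseudoMetricSpace Z] {u : P.E0 → Z} {z : Z},
        ContinuousAt u yd → u yd = z → ∀ᶠ y in 𝓝 yd, u y ∈ Metric.ball z (ε i) := by
      rintro Z _ u z hu rfl
      exact hu.eventually_mem (Metric.ball_mem_nhds _ (hε i))
    filter_upwards [hnear (hXc (hφC i)).continuousAt (hpass i).1,
      hnear (hMtc (hφC i)).continuousAt (hpass i).2.1,
      hnear (hLtc (hφC i)).continuousAt (hpass i).2.2.1,
      hnear (hMc (hφC i)).continuousAt (hpass i).2.2.2,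
      Metric.ball_mem_nhds yd (hε i)] with y h1 h2 h3 h4 h5
    refine ⟨⟨h1, h2, h3, h4⟩, fun x hx μt hμt lam hlam μ hμ hK => ?_⟩
    -- In the sup metric, balls of common radius `ε i` around the components make up a ball around
    -- the tuple.
    have heq := @hball i (y, (x, Sum.elim μt μ, lam)) (by
      simp only [Prod.dist_eq, max_lt_iff]
      refine ⟨h5, hx, (dist_pi_lt_iff (hε i)).mpr ?_, hlam⟩
      rintro (j | j)
      · exact (dist_le_pi_dist μt (μtd i) j).trans_lt hμt
      · exact (dist_le_pi_dist μ (μd i) j).trans_lt hμ) hK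
    have heq' : (x, Sum.elim μt μ, lam) = φ i y := heq
    refine ⟨congrArg Prod.fst heq', ?_, congrArg (fun p => p.2.2) heq', ?_⟩
    · funext j
      exact congrFun (congrArg (fun p => p.2.1) heq') (Sum.inl j)
    · funext j
      exact congrFun (congrArg (fun p => p.2.1) heq') (Sum.inr j)

end PDProblem

end

/-! ### The convex approximate problem -/

noncomputable section

/-- First-order optimality on a convex set. -/
theorem Convex.fderiv_nonneg_of_isMinOn {E : Type*} [NormedAddCommGroup E] [NormedSpace ℝ E]
    {s : Set E} (hs : Convex ℝ s) {f : E → ℝ} {f' : E →L[ℝ] ℝ} {x w : E} (hx : x ∈ s) (hw : w ∈ s)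
    (hf : HasFDerivAt f f' x) (hmin : ∀ u ∈ s, f x ≤ f u) : 0 ≤ f' (w - x) :=
  IsLocalMinOn.hasFDerivWithinAt_nonneg (IsMinOn.localize hmin) hf.hasFDerivWithinAt
    (sub_mem_posTangentConeAt_of_segment_subset (hs.segment_subset hx hw))

/-- If a function and its linearisation are such that `f x ≤ 0` and `f x + f' v < 0`, then `f` is
negative at points slightly away from `x` in the direction `v`. -/
theorem HasFDerivAt.eventually_neg_of_add_neg {E : Type*} [NormedAddCommGroup E] [NormedSpace ℝ E]
    {f : E → ℝ} {f' : E →L[ℝ] ℝ} {x v : E} (hf : HasFDerivAt f f' x) (hx : f x ≤ 0)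
    (hv : f x + f' v < 0) : ∀ᶠ t : ℝ in 𝓝[>] 0, f (x + t • v) < 0 := by
  have hl : HasDerivAt (fun t : ℝ => f (x + t • v)) (f' v) 0 := by
    have h1 : HasDerivAt (fun t : ℝ => x + t • v) v 0 := by
      simpa using ((hasDerivAt_id (0 : ℝ)).smul_const v).const_add x
    have h2 : HasFDerivAt f f' (x + (0 : ℝ) • v) := by simpa using hf
    exact h2.comp_hasDerivAt (0 : ℝ) h1
  have hlim := hl.tendsto_slope_zero_right
  simp only [zero_add, zero_smul, add_zero, smul_eq_mul] at hlim
  -- A difference quotient below `-f x` means `f (x + t • v) < (1 - t) * f x`, which is nonpositive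
  -- for `t < 1`.
  have hev := hlim.eventually (gt_mem_nhds (show f' v < -f x by linarith))
  have h1 : ∀ᶠ t : ℝ in 𝓝[>] 0, t < 1 := nhdsWithin_le_nhds (gt_mem_nhds one_pos)
  filter_upwards [hev, h1, self_mem_nhdsWithin] with t ht ht1 ht0
  have ht0 : 0 < t := ht0
  rw [inv_mul_lt_iff₀ ht0] at ht
  nlinarith

namespace PDProblem

variable {P : PDProblem} {F0 : P.E0 → P.E0 → ℝ} {G0 : P.E0 → P.E0 → Fin P.r0 → ℝ} {c τ : ℝ}

theorem IsConstrSurrogate.convex_feasible (hP : P.Standing) (hG : P.IsConstrSurrogate G0)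
    {z : P.E0} (hz : z ∈ P.Y) (d : P.E0 →L[ℝ] ℝ) :
    Convex ℝ {w | (P.approxMaster F0 G0 τ z d).IsFeasible w} := by
  intro w hw w' hw' p q hp hq hpq
  refine ⟨hP.Y_convex hw.1 hw'.1 hp hq hpq, fun j => ?_, fun l => l.elim0⟩
  refine ((hG.convex z hz j).2 hw.1 hw'.1 hp hq hpq).trans ?_
  have h1 : G0 w z j ≤ 0 := hw.2.1 j
  have h2 : G0 w' z j ≤ 0 := hw'.2.1 j
  have h3 := mul_nonpos_of_nonneg_of_nonpos hp h1
  have h4 := mul_nonpos_of_nonneg_of_nonpos hq h2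
  simpa using add_nonpos h3 h4

theorem IsConstrSurrogate.isFeasible_self (hG : P.IsConstrSurrogate G0) {z : P.E0}
    (hz : z ∈ P.Y) (hz0 : ∀ j, P.g0 j z ≤ 0) (d : P.E0 →L[ℝ] ℝ) :
    (P.approxMaster F0 G0 τ z d).IsFeasible z :=
  ⟨hz, fun j => (hG.eq_self z hz j).trans_le (hz0 j), fun l => l.elim0⟩

/-- The variational inequality that characterises a minimiser of the approximate problem. -/
theorem IsObjSurrogate.variational (hP : P.Standing) (hF : P.IsObjSurrogate F0 c)
    (hG : P.IsConstrSurrogate G0) {z u : P.E0} (hz : z ∈ P.Y) {d : P.E0 →L[ℝ] ℝ}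
    (hu : (P.approxMaster F0 G0 τ z d).IsFeasible u)
    (hmin : ∀ w, (P.approxMaster F0 G0 τ z d).IsFeasible w →
      (P.approxMaster F0 G0 τ z d).f u ≤ (P.approxMaster F0 G0 τ z d).f w)
    {w : P.E0} (hw : (P.approxMaster F0 G0 τ z d).IsFeasible w) :
    0 ≤ (fderiv ℝ (fun y => F0 y z) u + (τ • innerSL ℝ (u - z) + d)) (w - u) := by
  refine (hG.convex_feasible hP hz d).fderiv_nonneg_of_isMinOn hu hw ?_ hmin
  have h1 : HasFDerivAt (fun y => F0 y z) (fderiv ℝ (fun y => F0 y z) u) u :=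
    (((hF.diff z hz).contDiffAt (hP.V_open.mem_nhds (hP.Y_subset hu.1))).differentiableAt
      one_ne_zero).hasFDerivAt
  have hsub : HasFDerivAt (fun y => y - z) (.id ℝ P.E0) u := (hasFDerivAt_id u).sub_const z
  have h2 : HasFDerivAt (fun y => τ / 2 * ‖y - z‖ ^ 2) (τ • innerSL ℝ (u - z)) u := by
    convert! hsub.norm_sq.const_mul (τ / 2) using 1
    ext v
    simp
    ring
  have h3 : HasFDerivAt (fun y => d (y - z)) d u := by
    exact d.hasFDerivAt.comp u hsub
  exact h1.add (h2.add h3)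

/-- The minimiser of the approximate problem gives a descent direction. -/
theorem IsObjSurrogate.descent (hP : P.Standing) (hF : P.IsObjSurrogate F0 c)
    (hG : P.IsConstrSurrogate G0) {z u : P.E0} (hz : z ∈ P.Y) (hz0 : ∀ j, P.g0 j z ≤ 0)
    {d : P.E0 →L[ℝ] ℝ} (hu : (P.approxMaster F0 G0 τ z d).IsFeasible u)
    (hmin : ∀ w, (P.approxMaster F0 G0 τ z d).IsFeasible w →
      (P.approxMaster F0 G0 τ z d).f u ≤ (P.approxMaster F0 G0 τ z d).f w) :
    (fderiv ℝ P.f0 z + d) (u - z) ≤ -((c + τ) * ‖u - z‖ ^ 2) := by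
  -- Testing with `z` itself: monotonicity of the surrogate gradient contributes `c`, the proximal
  -- term `τ`.
  have h1 := hF.variational hP hG hz hu hmin (hG.isFeasible_self hz hz0 d)
  have h2 := hF.mono u hu.1 z hz z hz
  rw [hF.grad_eq z hz] at h2
  rw [← neg_sub u z, map_neg] at h1
  simp only [add_apply, sub_apply, smul_apply, innerSL_apply_apply,
    real_inner_self_eq_norm_sq, smul_eq_mul] at h1 h2 ⊢
  linarith

/-- If the minimisers of the approximate problems approach the points at which these are formed, a
limit of these points is stationary. -/
theorem exists_multipliers_of_tendsto (hP : P.Standing) (hF : P.IsObjSurrogate F0 c)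
    (hG : P.IsConstrSurrogate G0) {z u : ℕ → P.E0} {d : ℕ → P.E0 →L[ℝ] ℝ} {p : P.E0}
    {L : P.E0 →L[ℝ] ℝ} (hz : ∀ k, z k ∈ P.Y)
    (hu : ∀ k, (P.approxMaster F0 G0 τ (z k) (d k)).IsFeasible (u k))
    (hmin : ∀ k w, (P.approxMaster F0 G0 τ (z k) (d k)).IsFeasible w →
      (P.approxMaster F0 G0 τ (z k) (d k)).f (u k) ≤ (P.approxMaster F0 G0 τ (z k) (d k)).f w)
    (hpY : p ∈ P.Y) (hp0 : ∀ j, P.g0 j p ≤ 0) (hzp : Tendsto z atTop (𝓝 p))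
    (huz : Tendsto (fun k => ‖u k - z k‖) atTop (𝓝 0))
    (hL : Tendsto (fun k => fderiv ℝ P.f0 (z k) + d k) atTop (𝓝 L))
    {X : (i : Fin P.I) → P.E0 → P.E i} (hreg : (P.master X).IsRegularAt p) :
    ∃ μ : Fin P.r0 → ℝ, (∀ j, 0 ≤ μ j) ∧ (∀ j, μ j * P.g0 j p = 0) ∧
      ∀ w ∈ P.Y, 0 ≤ L (w - p) + ∑ j, μ j * fderiv ℝ (P.g0 j) p (w - p) := by
  have hpV := hP.Y_subset hpY
  have huz' : Tendsto (fun k => u k - z k) atTop (𝓝 0) := tendsto_zero_iff_norm_tendsto_zero.mpr huz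
  have hup : Tendsto u atTop (𝓝 p) := by simpa using huz'.add hzp
  refine hP.Y_convex.exists_multipliers hpY (L : P.E0 →ₗ[ℝ] ℝ) (fun j => P.g0 j p)
    (fun j => (fderiv ℝ (P.g0 j) p : P.E0 →ₗ[ℝ] ℝ)) hp0 ?_ ?_
  · intro w hw hneg
    have hgrad : Tendsto (fun k => fderiv ℝ (fun y => F0 y (z k)) (u k)
        + (τ • innerSL ℝ (u k - z k) + d k)) atTop (𝓝 L) := by
      have h1 : Tendsto (fun k => fderiv ℝ (fun y => F0 y (z k)) (u k)) atTop
          (𝓝 (fderiv ℝ P.f0 p)) := by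
        rw [← hF.grad_eq p hpY]
        exact (hF.grad_cont (p, p) ⟨hpV, hpY⟩).tendsto.comp
          (tendsto_nhdsWithin_iff.mpr ⟨hup.prodMk_nhds hzp,
            Eventually.of_forall fun k => ⟨hP.Y_subset (hu k).1, hz k⟩⟩)
      have h2 : Tendsto (fun k => τ • innerSL ℝ (u k - z k)) atTop (𝓝 0) := by
        have := (((innerSL ℝ).continuous.tendsto (0 : P.E0)).comp huz').const_smul τ
        simpa using this
      have h3 : Tendsto (fun k => fderiv ℝ P.f0 (z k)) atTop (𝓝 (fderiv ℝ P.f0 p)) :=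
        ((hP.f0_diff.continuousOn_fderiv_of_isOpen hP.V_open le_rfl).continuousAt
          (hP.V_open.mem_nhds hpV)).tendsto.comp hzp
      -- Here `d k` is written as `(∇f0 (z k) + d k) - ∇f0 (z k)`; both gradients of `f0` and the
      -- surrogate's tend to `∇f0 p` and cancel.
      have h4 := h1.add (h2.add (hL.sub h3))
      simpa using h4
    -- Strict feasibility of a short step for `G0 (· ; p)` survives, by continuity in the base
    -- point, for `G0 (· ; z k)`; the step is then an admissible test point.
    have hsmall : ∀ᶠ t : ℝ in 𝓝[>] 0, t < 1 ∧ ∀ j, G0 (p + t • (w - p)) p j < 0 := by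
      refine Eventually.and (nhdsWithin_le_nhds (gt_mem_nhds one_pos)) (eventually_all.mpr fun j => ?_)
      have hd := (hG.diff p hpY p hpY j).hasFDerivAt
      rw [hG.grad_eq p hpY j] at hd
      refine hd.eventually_neg_of_add_neg ?_ ?_
      · rw [hG.eq_self p hpY j]; exact hp0 j
      · rw [hG.eq_self p hpY j]; exact hneg j
    obtain ⟨t, ⟨ht1, htG⟩, ht0⟩ := (hsmall.and self_mem_nhdsWithin).exists
    have ht0 : 0 < t := ht0
    have hwt : p + t • (w - p) ∈ P.Y := hP.Y_convex.add_smul_sub_mem hpY hw ⟨ht0.le, ht1.le⟩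
    have hfeas : ∀ᶠ k in atTop,
        (P.approxMaster F0 G0 τ (z k) (d k)).IsFeasible (p + t • (w - p)) := by
      have : ∀ᶠ k in atTop, ∀ j, G0 (p + t • (w - p)) (z k) j < 0 := by
        refine eventually_all.mpr fun j => ?_
        have hc : Tendsto (fun k => G0 (p + t • (w - p)) (z k) j) atTop
            (𝓝 (G0 (p + t • (w - p)) p j)) :=
          (hG.cont j (p + t • (w - p), p) ⟨hwt, hpY⟩).tendsto.comp
            (tendsto_nhdsWithin_iff.mpr ⟨tendsto_const_nhds.prodMk_nhds hzp,
              Eventually.of_forall fun k => ⟨hwt, hz k⟩⟩)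
        exact hc.eventually (gt_mem_nhds (htG j))
      exact this.mono fun k hk => ⟨hwt, fun j => (hk j).le, fun l => l.elim0⟩
    have happ : ∀ {A : ℕ → P.E0 →L[ℝ] ℝ} {v : ℕ → P.E0} {v₀ : P.E0}, Tendsto A atTop (𝓝 L) →
        Tendsto v atTop (𝓝 v₀) → Tendsto (fun k => A k (v k)) atTop (𝓝 (L v₀)) := fun hA hv =>
      ((isBoundedBilinearMap_apply (𝕜 := ℝ) (E := P.E0) (F := ℝ)).continuous.tendsto
        (L, _)).comp (hA.prodMk_nhds hv)
    have hlim := happ hgrad (hup.const_sub (p + t • (w - p)))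
    have := ge_of_tendsto hlim (hfeas.mono fun k hk =>
      hF.variational hP hG (hz k) (hu k) (hmin k) hk)
    rw [add_sub_cancel_left, map_smul, smul_eq_mul] at this
    exact nonneg_of_mul_nonneg_right this ht0
  · intro μ hμ hμ0 hμc
    refine (hreg μ 0 (fun w hw => ?_) hμ0 hμc).1
    have := hμ w hw
    simpa [master] using this

/-! ### Convergence of a run that follows the branch -/

variable {γ : ℕ → ℝ} {y : ℕ → P.E0} {x : ℕ → ∀ i, P.E i} {μt : ℕ → ∀ i, Fin (P.rt i) → ℝ}
  {lam : ℕ → ∀ i, Fin (P.mt i) → ℝ} {μ : ℕ → ∀ i, Fin (P.r i) → ℝ}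

/-- As long as the subproblems are feasible, the iterates are feasible for the master problem. -/
theorem IsRun.feasible (hP : P.Standing) (hG : P.IsConstrSurrogate G0) (hγ : IsStepSize γ)
    (hrun : P.IsRun F0 G0 τ γ y x μt lam μ) (hdom : ∀ k, y k ∈ P.domDag) (k : ℕ) :
    y k ∈ P.Y ∧ ∀ j, P.g0 j (y k) ≤ 0 := by
  induction k with
  | zero => exact ⟨hrun.init_mem, hrun.init_le⟩
  | succ k ih =>
    obtain ⟨u, hu, -, hstep⟩ := hrun.step k (hdom k)
    -- The new iterate is a convex combination of two points of the convex approximate feasible set,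
    -- and `G0` dominates `g0`.
    have h := (hG.convex_feasible hP ih.1 _).add_smul_sub_mem (hG.isFeasible_self ih.1 ih.2 _) hu
      ⟨(hγ.pos k).le, hγ.le_one k⟩
    rw [← hstep] at h
    exact ⟨h.1, fun j => (hG.upper _ h.1 _ ih.1 j).trans (h.2.1 j)⟩

/-- Convergence of a run whose iterates stay in a compact convex set on which the gradient of the
master objective is Lipschitz, and at which the computed points are those of the branch. -/
theorem IsRun.convergence (hP : P.Standing) (hreg : P.MasterRegular) {D : Set P.E0} {B : P.Branch}
    (hB : P.IsStationaryBranch D B) {N : Set P.E0} (hND : N ⊆ D) (hNc : IsCompact N)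
    (hNconv : Convex ℝ N) {K : NNReal} (hK : LipschitzOnWith K (fderiv ℝ (P.fDag B.X)) N)
    (hcτ : 0 < c + τ) (hF : P.IsObjSurrogate F0 c) (hG : P.IsConstrSurrogate G0)
    (hγ : IsStepSize γ) (hrun : P.IsRun F0 G0 τ γ y x μt lam μ) (hy : ∀ k, y k ∈ N)
    (hx : ∀ k i, x k i = B.X i (y k)) (hμt : ∀ k i, μt k i = B.Mt i (y k))
    (hlam : ∀ k i, lam k i = B.Lt i (y k)) :
    Tendsto (fun k => ‖y (k + 1) - y k‖) atTop (𝓝 0) ∧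
    ∀ (φ : ℕ → ℕ) (p : P.E0), StrictMono φ → Tendsto (fun k => y (φ k)) atTop (𝓝 p) →
      P.GoodLimit D B.X y x φ p := by
  have hdom : ∀ k, y k ∈ P.domDag := fun k => hB.D_subset (hND (hy k))
  have hfeas := hrun.feasible hP hG hγ hdom
  choose u hu hmin hstep using fun k => hrun.step k (hdom k)
  set d : ℕ → P.E0 →L[ℝ] ℝ := fun k => ∑ i, P.gradDag i (x k i) (y k) (μt k i) (lam k i) with hd
  have hgrad : ∀ k, fderiv ℝ P.f0 (y k) + d k = fderiv ℝ (P.fDag B.X) (y k) := fun k => by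
    rw [(hB.hasFDerivAt_fDag hP (hND (hy k))).fderiv]
    simp only [hd, hx, hμt, hlam]
  have hdiff : ∀ w ∈ N, DifferentiableAt ℝ (P.fDag B.X) w := fun w hw =>
    (hB.hasFDerivAt_fDag hP (hND hw)).differentiableAt
  set a : ℕ → ℝ := fun k => ‖u k - y k‖ with ha
  have hdesc : ∀ k, fderiv ℝ (P.fDag B.X) (y k) (u k - y k) ≤ -((c + τ) * a k ^ 2) := fun k => by
    rw [← hgrad]
    exact hF.descent hP hG (hfeas k).1 (hfeas k).2 (hu k) (hmin k)
  have hsub : ∀ k, y (k + 1) - y k = γ k • (u k - y k) := fun k => by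
    rw [hstep k, add_sub_cancel_left]
  have hnorm : ∀ k, ‖y (k + 1) - y k‖ = γ k * a k := fun k => by
    rw [hsub, norm_smul, Real.norm_of_nonneg (hγ.pos k).le]
  obtain ⟨b, hb⟩ : BddBelow (P.fDag B.X '' N) :=
    hNc.bddBelow_image fun w hw => (hdiff w hw).continuousAt.continuousWithinAt
  have hsum : Summable fun k => γ k * a k ^ 2 := by
    refine summable_mul_sq_of_decrease (v := fun k => P.fDag B.X (y k)) (L := K) hcτ hγ.pos
      hγ.tendsto_zero (fun k => hb (Set.mem_image_of_mem _ (hy k))) fun k => ?_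
    have h1 := hNconv.le_add_fderiv_add_of_lipschitzOnWith hdiff hK (hy k) (hy (k + 1))
    rw [hnorm, hsub, map_smul, smul_eq_mul] at h1
    have h2 := mul_le_mul_of_nonneg_left (hdesc k) (hγ.pos k).le
    linarith
  refine ⟨?_, fun φ p hφ hp => ?_⟩
  · obtain ⟨C, hC⟩ := hNc.exists_bound_of_continuousOn hK.continuousOn
    -- Descent gives `(c + τ) a² ≤ ‖∇f†‖ a`, which bounds the search directions although `P.Y` may
    -- be unbounded.
    have hbound : ∀ k, a k ≤ C / (c + τ) := fun k => by
      rw [le_div_iff₀ hcτ]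
      have h1 := (fderiv ℝ (P.fDag B.X) (y k)).le_opNorm (u k - y k)
      have h2 := neg_abs_le (fderiv ℝ (P.fDag B.X) (y k) (u k - y k))
      have h3 := mul_le_mul_of_nonneg_right (hC _ (hy k)) (norm_nonneg (u k - y k))
      rw [Real.norm_eq_abs] at h1
      have h4 : (a k * (c + τ)) * a k ≤ C * a k := by linarith [hdesc k]
      rcases (norm_nonneg (u k - y k)).eq_or_lt with h0 | h0
      · have h5 : a k = 0 := h0.symm
        rw [h5, zero_mul]
        exact (norm_nonneg _).trans (hC _ (hy k))
      · exact le_of_mul_le_mul_right h4 h0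
    simp only [hnorm]
    have hlim := hγ.tendsto_zero.mul_const (C / (c + τ))
    rw [zero_mul] at hlim
    exact squeeze_zero (fun k => mul_nonneg (hγ.pos k).le (norm_nonneg _))
      (fun k => mul_le_mul_of_nonneg_left (hbound k) (hγ.pos k).le) hlim
  · have hpN : p ∈ N := hNc.isClosed.mem_of_tendsto hp (Eventually.of_forall fun k => hy _)
    have hpD := hND hpN
    have hpY : p ∈ P.Y :=
      hP.Y_closed.mem_of_tendsto hp (Eventually.of_forall fun k => (hfeas _).1)
    have hp0 : ∀ j, P.g0 j p ≤ 0 := fun j =>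
      le_of_tendsto ((hP.g0_differentiableAt (hP.Y_subset hpY) j).continuousAt.tendsto.comp hp)
        (Eventually.of_forall fun k => (hfeas _).2 j)
    have hpfeas : (P.master B.X).IsFeasible p := ⟨hpY, hp0, fun l => l.elim0⟩
    -- Along `φ` itself `a` need not tend to zero. Only the point `p` is retained, and a different
    -- subsequence `ψ` with the same limit carries the stationarity argument.
    have hcl : MapClusterPt p atTop y := hp.mapClusterPt.of_comp hφ.tendsto_atTop
    obtain ⟨ψ, hψ, hyψ, haψ⟩ := exists_subseq_tendsto_of_frequently (a := a)
      (fun k => norm_nonneg _) fun ε hε =>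
        frequently_dist_lt_and_lt_of_mapClusterPt hγ.pos (fun k => norm_nonneg _) hγ.sum_diverges
          hsum (fun k => by rw [dist_eq_norm, hnorm]) hcl hε
    have hL : Tendsto (fun k => fderiv ℝ P.f0 (y (ψ k)) + d (ψ k)) atTop
        (𝓝 (fderiv ℝ (P.fDag B.X) p)) := by
      simp only [hgrad]
      exact (hK.continuousOn p hpN).tendsto.comp
        (tendsto_nhdsWithin_iff.mpr ⟨hyψ, Eventually.of_forall fun k => hy _⟩)
    obtain ⟨ν, hν, hνc, hνv⟩ := exists_multipliers_of_tendsto hP hF hG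
      (fun k => (hfeas (ψ k)).1) (fun k => hu (ψ k)) (fun k => hmin (ψ k)) hpY hp0 hyψ haψ hL
      (hreg B.X p (hB.D_subset hpD) hpfeas)
    have hstat : (P.master B.X).IsStationary p :=
      ⟨ν, 0, fun w hw => by
        simpa [NLP.lagrangeDeriv_apply, master] using hνv w hw, hνc, hν, hpfeas⟩
    refine ⟨hp, hpD, hstat, fun i => B.X i p, fun i => ⟨?_, hB.interior i p hpD⟩,
      hB.full_isStationary hP hpD hstat⟩
    simp only [hx]
    exact (hB.X_differentiableAt i hpD).continuousAt.tendsto.comp hp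

end PDProblem

end

/-! ### Choice of the neighbourhoods -/

theorem mainTheorem2 (P : PDProblem) (hP : P.Standing) (hreg : P.MasterRegular)
    (xd : ∀ i, P.E i) (yd : P.E0)
    (μtd : ∀ i, Fin (P.rt i) → ℝ) (lamd : ∀ i, Fin (P.mt i) → ℝ) (μd : ∀ i, Fin (P.r i) → ℝ)
    (hnd : P.Nondegenerate xd yd μtd lamd μd)
    (hlip : P.GradDagLipschitz xd yd μtd lamd μd) :
    ∃ (D : Set P.E0) (B : P.Branch) (Ny : Set P.E0) (Nx : ∀ i, Set (P.E i))
      (Nμt : ∀ i, Set (Fin (P.rt i) → ℝ)) (Nlam : ∀ i, Set (Fin (P.mt i) → ℝ))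
      (Nμ : ∀ i, Set (Fin (P.r i) → ℝ)),
      Ny ∈ 𝓝 yd ∧ (∀ i, Nx i ∈ 𝓝 (xd i)) ∧ (∀ i, Nμt i ∈ 𝓝 (μtd i)) ∧
      (∀ i, Nlam i ∈ 𝓝 (lamd i)) ∧ (∀ i, Nμ i ∈ 𝓝 (μd i)) ∧
      -- the stationary branch through the given point, which defines the master objective
      P.IsStationaryBranch D B ∧ Ny ⊆ D ∧ B.PassesThrough xd yd μtd lamd μd ∧
      (∀ y ∈ Ny, ∀ i, B.X i y ∈ Nx i ∧ B.Mt i y ∈ Nμt i ∧ B.Lt i y ∈ Nlam i ∧ B.M i y ∈ Nμ i) ∧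
      (∀ y ∈ Ny, ∀ i, ∀ x ∈ Nx i, ∀ μt ∈ Nμt i, ∀ lam ∈ Nlam i, ∀ μ ∈ Nμ i,
        (P.sub i y).KKT x (Sum.elim μt μ) lam →
        x = B.X i y ∧ μt = B.Mt i y ∧ lam = B.Lt i y ∧ μ = B.M i y) ∧
      -- convergence of every run that stays in the neighbourhoods
      ∀ (F0 : P.E0 → P.E0 → ℝ) (G0 : P.E0 → P.E0 → Fin P.r0 → ℝ) (c τ : ℝ) (γ : ℕ → ℝ)
        (y : ℕ → P.E0) (x : ℕ → ∀ i, P.E i) (μt : ℕ → ∀ i, Fin (P.rt i) → ℝ)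
        (lam : ℕ → ∀ i, Fin (P.mt i) → ℝ) (μ : ℕ → ∀ i, Fin (P.r i) → ℝ),
        0 ≤ c → 0 ≤ τ → 0 < c + τ →
        P.IsObjSurrogate F0 c → P.IsConstrSurrogate G0 → PDProblem.IsStepSize γ →
        P.IsRun F0 G0 τ γ y x μt lam μ →
        (∀ k, y k ∈ Ny) → (∀ k i, x k i ∈ Nx i) → (∀ k i, μt k i ∈ Nμt i) →
        (∀ k i, lam k i ∈ Nlam i) → (∀ k i, μ k i ∈ Nμ i) →
        (∃ (φ : ℕ → ℕ) (yInf : P.E0), StrictMono φ ∧ P.GoodLimit D B.X y x φ yInf) ∧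
        Tendsto (fun k => ‖y (k + 1) - y k‖) atTop (𝓝 0) ∧
        (P.ExtraConditions F0 G0 →
          ∀ (φ : ℕ → ℕ) (yInf : P.E0), StrictMono φ →
            Tendsto (fun k => y (φ k)) atTop (𝓝 yInf) → P.GoodLimit D B.X y x φ yInf) := by
  obtain ⟨D, B, Nx, Nμt, Nlam, Nμ, hyd, hNx, hNμt, hNlam, hNμ, hB, hpass, hloc⟩ :=
    hnd.exists_stationaryBranch hP
  obtain ⟨W, hW, hWD, K, hK⟩ := hlip D B hB hyd hpass
  -- Local uniqueness holds for all `y` near `yd` with the other neighbourhoods fixed, so the ball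
  -- can be shrunk into `W`. A closed ball is compact, keeping limits inside `D`, and convex, as the
  -- descent inequality requires.
  obtain ⟨ε, hε, hball⟩ := Metric.nhds_basis_closedBall.mem_iff.mp (inter_mem hW hloc)
  have hBW : Metric.closedBall yd ε ⊆ W := fun y hy => (hball hy).1
  refine ⟨D, B, Metric.closedBall yd ε, Nx, Nμt, Nlam, Nμ, Metric.closedBall_mem_nhds yd hε, hNx,
    hNμt, hNlam, hNμ, hB, hBW.trans hWD, hpass, fun y hy i => ((hball hy).2 i).1,
    fun y hy i => ((hball hy).2 i).2, ?_⟩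
  intro F0 G0 c τ γ y x μt lam μ _ _ hcτ hF hG hγ hrun hyN hxN hμtN hlamN hμN
  -- Every iterate lies in `P.domDag`, so its subproblems are solved, and local uniqueness
  -- identifies the computed points and multipliers with the branch.
  have hbranch := fun k i => ((hball (hyN k)).2 i).2 (x k i) (hxN k i) (μt k i) (hμtN k i)
    (lam k i) (hlamN k i) (μ k i) (hμN k i)
    (hrun.subproblem k (hB.D_subset (hWD (hBW (hyN k)))) i)
  have hcomp : IsCompact (Metric.closedBall yd ε) := isCompact_closedBall yd ε
  obtain ⟨hstep, hlim⟩ := hrun.convergence hP hreg hB (hBW.trans hWD) hcomp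
    (convex_closedBall yd ε) (hK.mono hBW) hcτ hF hG hγ hyN (fun k i => (hbranch k i).1)
    (fun k i => (hbranch k i).2.1) (fun k i => (hbranch k i).2.2.1)
  obtain ⟨p, -, φ, hφ, hp⟩ := hcomp.tendsto_subseq hyN
  exact ⟨⟨φ, p, hφ, hlim φ p hφ hp⟩, hstep, fun _ => hlim⟩
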